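/- Let $\nu>0$ and $\alpha_1,\alpha_2\in\mathbb R$. Let $\dot H^2(0,2\pi)$ be the space of $2\pi$-periodic real functions with zero mean that have two weak derivatives in $L^2(0,2\pi)$, and consider the coupled Kuramoto--Sivashinsky system with $2\pi$-periodic boundary conditions $$\begin{aligned} u_{1,t} &= -\nu u_{1,xxxx}-u_{1,xx}-u_1u_{1,x}-\alpha_1u_{2,xx},\\ u_{2,t} &= -\nu u_{2,xxxx}-u_{2,xx}-u_2u_{2,x}-\alpha_2u_{1,xx},\end{aligned}\qquad u_1(\cdot,0)=u_{10},\quad u_2(\cdot,0)=u_{20},$$ with $u_{10},u_{20}\in\dot H^2(0,2\pi)$. A solution on $[0,T]$ is a pair $(u_1,u_2)$ in $C([0,T];\dot H^2(0,2\pi))^2$ that has these initial values and satisfies the equations weakly, i.e. when they are integrated over $[0,t]$ for every $t\in[0,T]$ and tested against every smooth $2\pi$-periodic function of $x$. Then there are constants $C,D>0$, depending only on $\nu,\alpha_1,\alpha_2$, such that for all $u_{10},u_{20}\in\dot H^2(0,2\pi)$, all $T>0$, every solution on $[0,T]$ and every $t\in[0,T]$, $$\|u_1(t)\|_{L^2}+\|u_2(t)\|_{L^2}\le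 C+C\left(\|u_{10}\|_{L^2}+\|u_{20}\|_{L^2}\right)e^{-Dt}.$$ Similarly, for $k=1,2$ and every $R$ there is a constant $M$, depending only on $\nu,\alpha_1,\alpha_2,k,R$, such that, whenever $\|u_{10}\|_{H^k}+\|u_{20}\|_{H^k}\le R$, for all $T>0$, every solution on $[0,T]$ and every $t\in[0,T]$, $$\|u_1(t)\|_{H^k}+\|u_2(t)\|_{H^k}\le C+Me^{-Dt}.$$ Moreover, for $k=2$ the functions $u_1(t),u_2(t)$ belong to $L^\infty(0,2\pi)$ and $\|u_1(t)\|_{L^\infty}+\|u_2(t)\|_{L^\infty}\le C+Me^{-Dt}$ as well. In particular, every solution is bounded uniformly in time in $L^2$, $H^1$, $H^2$ and $L^\infty$, and after a time depending only on the size of the initial data these norms are at most $2C$, which depends only on $\nu,\alpha_1,\alpha_2$. -/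

import Mathlib

noncomputable section

namespace KSSystem

open MeasureTheory Set

/-- Lebesgue measure on the period cell `(0, 2π]`. -/
abbrev cell : Measure ℝ := volume.restrict (Ioc (0 : ℝ) (2 * Real.pi))

/-- The real Hilbert space `L²(0,2π)`, with `‖f‖² = ∫₀^{2π} f²`. -/
abbrev L2 : Type := Lp ℝ 2 cell

/-- Smooth `2π`-periodic test functions. -/
def IsTest (φ : ℝ → ℝ) : Prop :=
  ContDiff ℝ (⊤ : ℕ∞) φ ∧ Function.Periodic φ (2 * Real.pi)

/-- `g` is the weak derivative of `f` on the circle `ℝ / 2πℤ`. Testing against periodic functions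
(and not only against functions supported inside `(0, 2π)`) encodes the periodic boundary
conditions. -/
def HasWeakDeriv (f g : L2) : Prop :=
  ∀ φ : ℝ → ℝ, IsTest φ → ∫ x, f x * deriv φ x ∂cell = -∫ x, g x * φ x ∂cell

/-- The space of `2π`-periodic `H²` functions with zero mean. An element is recorded as the function
together with its first two weak derivatives, which are determined by the function. -/
@[ext]
structure HDot2 where
  /-- the function -/
  val : L2
  /-- its first weak derivative -/
  d1 : L2
  /-- its second weak derivative -/
  d2 : L2
  hasWeakDeriv_val : HasWeakDeriv val d1
  hasWeakDeriv_d1 : HasWeakDeriv d1 d2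
  mean_zero : ∫ x, val x ∂cell = 0

/-- The `L²` norm. -/
def HDot2.normL2 (f : HDot2) : ℝ := ‖f.val‖

/-- The `H¹` norm. -/
def HDot2.normH1 (f : HDot2) : ℝ := Real.sqrt (‖f.val‖ ^ 2 + ‖f.d1‖ ^ 2)

/-- The `H²` norm. -/
def HDot2.normH2 (f : HDot2) : ℝ := Real.sqrt (‖f.val‖ ^ 2 + ‖f.d1‖ ^ 2 + ‖f.d2‖ ^ 2)

/-- Continuity on `[0,T]` of a curve in the `H²` norm. -/
def ContinuousInH2 (T : ℝ) (u : ℝ → HDot2) : Prop :=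
  ContinuousOn (fun t => (u t).val) (Icc 0 T) ∧
  ContinuousOn (fun t => (u t).d1) (Icc 0 T) ∧
  ContinuousOn (fun t => (u t).d2) (Icc 0 T)

/-- The pairing of `-ν u_xxxx - u_xx - u u_x - α w_xx` with a test function `φ`, all derivatives
being moved onto `φ` (and `u u_x = (u²/2)_x`). -/
def weakRHS (ν α : ℝ) (u w : L2) (φ : ℝ → ℝ) : ℝ :=
  ∫ x, (-ν * u x * iteratedDeriv 4 φ x - u x * iteratedDeriv 2 φ x
    + (u x) ^ 2 / 2 * deriv φ x - α * w x * iteratedDeriv 2 φ x) ∂cell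

/-- `u`, given `w`, satisfies `u_t = -ν u_xxxx - u_xx - u u_x - α w_xx` weakly (integrated in time)
on `[0,T]`. -/
def WeakEquation (ν α T : ℝ) (u w : ℝ → HDot2) : Prop :=
  ∀ φ : ℝ → ℝ, IsTest φ → ∀ t ∈ Icc 0 T,
    (∫ x, (u t).val x * φ x ∂cell) - (∫ x, (u 0).val x * φ x ∂cell)
      = ∫ s in (0 : ℝ)..t, weakRHS ν α (u s).val (w s).val φ

/-- `(u₁, u₂) ∈ C([0,T]; Ḣ²)²` is a (weak) solution on `[0,T]` of
`u₁_t = -ν u₁_xxxx - u₁_xx - u₁ u₁_x - α₁ u₂_xx`,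
`u₂_t = -ν u₂_xxxx - u₂_xx - u₂ u₂_x - α₂ u₁_xx`,
with periodic boundary conditions and initial data `u₁₀, u₂₀`. -/
structure IsSolution (ν α₁ α₂ T : ℝ) (u₁₀ u₂₀ : HDot2) (u₁ u₂ : ℝ → HDot2) : Prop where
  continuous₁ : ContinuousInH2 T u₁
  continuous₂ : ContinuousInH2 T u₂
  initial₁ : u₁ 0 = u₁₀
  initial₂ : u₂ 0 = u₂₀
  equation₁ : WeakEquation ν α₁ T u₁ u₂
  equation₂ : WeakEquation ν α₂ T u₂ u₁

end KSSystem

end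

noncomputable section

namespace KSSystem

open MeasureTheory Set Filter Topology
open scoped RealInnerProductSpace

/-! ### Test functions as elements of `L²` -/

/-! The `L²` bound is the heart of the matter. Pairing each equation with its own unknown removes
the quadratic term, but the antidiffusion and the coupling can still pump energy into low modes. The
remedy is a gauge: instead of `‖u‖`, follow the distance of `u` to the set of all translates of one
fixed smooth mean-zero function `φ`. For a fixed translate `v`, the derivative of `‖u - v‖² / 2`
contains the new term `-½ ∫ u² v'`. Take `φ' = λ - λ · (2π / mass) · kernel`, with a kernel
concentrated at `0`; then this term is `-(λ/2) ‖u‖²` plus a multiple of the kernel-weighted mean of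
`u²`. At a nearest translate `u` is orthogonal to `v'`, and since `u` has zero mean this forces the
weighted mean of `u` to vanish. The bad term is therefore a variance, which a concentrated kernel
makes at most a small multiple of `‖u_xx‖²` (`exists_gauge`). So `λ` can be as large as needed, at
the cost of a small part of the viscosity.

The nearest translate is chosen for each component separately and need not depend continuously on
time. Freezing it at the current time bounds the right Dini derivative of the squared distance, and
this suffices for Gronwall (`exists_dissipative_orbit`). The squared distances decay at rate `ν` to
a constant, hence norms at rate `ν / 2` (`exists_L2_bound`).

Higher norms come from Fourier coefficients. The `k`-th coefficient solves a scalar linear equation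
with damping `ν k⁴` and forcing of size `k²` times the coefficients plus `|k| ‖u‖²` (`forcing`).
Duhamel with the `L²` bound gives, beyond the decaying initial part, decay `k⁻²`
(`coeff_bound_one`); inserting this once more gives `|k|⁻³` (`coeff_bound_two`). After two
derivatives `|k|⁻¹` is left, which is square summable, so Parseval yields `H¹` and `H²`. The
one-dimensional Sobolev inequality gives `L^∞`. -/

theorem IsTest.continuous {φ : ℝ → ℝ} (h : IsTest φ) : Continuous φ := h.1.continuous

theorem IsTest.differentiable {φ : ℝ → ℝ} (h : IsTest φ) : Differentiable ℝ φ :=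
  h.1.differentiable (by simp)

theorem IsTest.hasDerivAt {φ : ℝ → ℝ} (h : IsTest φ) (x : ℝ) : HasDerivAt φ (deriv φ x) x :=
  (h.differentiable x).hasDerivAt

theorem IsTest.deriv {φ : ℝ → ℝ} (h : IsTest φ) : IsTest (deriv φ) := by
  refine ⟨(contDiff_infty_iff_deriv.1 h.1).2, fun x => ?_⟩
  rw [← deriv_comp_add_const]
  congr 1
  exact funext h.2

theorem IsTest.exists_bound {φ : ℝ → ℝ} (h : IsTest φ) : ∃ B, ∀ x, |φ x| ≤ B := by
  obtain ⟨B, hB⟩ := h.2.isBounded_of_continuous Real.two_pi_pos.ne' h.continuous |>.exists_norm_le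
  exact ⟨B, fun x => hB _ ⟨x, rfl⟩⟩

theorem IsTest.memLp {φ : ℝ → ℝ} (h : IsTest φ) (p : ENNReal) : MemLp φ p cell := by
  obtain ⟨B, hB⟩ := h.exists_bound
  exact MemLp.of_bound h.continuous.aestronglyMeasurable B (ae_of_all _ hB)

/-- The class in `L²` of a test function. -/
def IsTest.toL2 {φ : ℝ → ℝ} (h : IsTest φ) : L2 := (h.memLp 2).toLp φ

theorem IsTest.coeFn_toL2 {φ : ℝ → ℝ} (h : IsTest φ) : h.toL2 =ᵐ[cell] φ := (h.memLp 2).coeFn_toLp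

theorem inner_eq_integral (f g : L2) : ⟪f, g⟫ = ∫ x, f x * g x ∂cell := by
  rw [L2.inner_def]
  exact integral_congr_ae (ae_of_all _ fun x => by simp [mul_comm])

theorem inner_toL2 (f : L2) {φ : ℝ → ℝ} (h : IsTest φ) : ⟪f, h.toL2⟫ = ∫ x, f x * φ x ∂cell := by
  rw [inner_eq_integral]
  exact integral_congr_ae (h.coeFn_toL2.mono fun x hx => by simp only [hx])

theorem inner_toL2_toL2 {φ ψ : ℝ → ℝ} (h : IsTest φ) (k : IsTest ψ) :
    ⟪h.toL2, k.toL2⟫ = ∫ x, φ x * ψ x ∂cell := by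
  rw [inner_toL2]
  exact integral_congr_ae (h.coeFn_toL2.mono fun x hx => by simp only [hx])

theorem integrable_mul (f g : L2) : Integrable (fun x => f x * g x) cell := by
  refine (L2.integrable_inner (𝕜 := ℝ) f g).congr (ae_of_all _ fun x => by simp [mul_comm])

theorem integrable_mul_test (f : L2) {φ : ℝ → ℝ} (h : IsTest φ) :
    Integrable (fun x => f x * φ x) cell :=
  (integrable_mul f h.toL2).congr (h.coeFn_toL2.mono fun x hx => by simp only [hx])

theorem norm_sq_eq_integral (f : L2) : ‖f‖ ^ 2 = ∫ x, f x ^ 2 ∂cell := by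
  rw [← real_inner_self_eq_norm_sq, inner_eq_integral]
  simp only [sq]

theorem integrable_sq (f : L2) : Integrable (fun x => f x ^ 2) cell := by
  simpa only [sq] using integrable_mul f f

theorem isTest_const (c : ℝ) : IsTest fun _ => c := ⟨contDiff_const, fun _ => rfl⟩

theorem IsTest.add {φ ψ : ℝ → ℝ} (h : IsTest φ) (k : IsTest ψ) : IsTest fun x => φ x + ψ x :=
  ⟨h.1.add k.1, h.2.add k.2⟩

theorem IsTest.sub {φ ψ : ℝ → ℝ} (h : IsTest φ) (k : IsTest ψ) : IsTest fun x => φ x - ψ x :=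
  ⟨h.1.sub k.1, h.2.sub k.2⟩

theorem IsTest.mul {φ ψ : ℝ → ℝ} (h : IsTest φ) (k : IsTest ψ) : IsTest fun x => φ x * ψ x :=
  ⟨h.1.mul k.1, h.2.mul k.2⟩

theorem IsTest.const_mul {φ : ℝ → ℝ} (h : IsTest φ) (c : ℝ) : IsTest fun x => c * φ x :=
  (isTest_const c).mul h

theorem IsTest.pow {φ : ℝ → ℝ} (h : IsTest φ) (n : ℕ) : IsTest fun x => φ x ^ n :=
  ⟨h.1.pow n, fun x => by simp only [h.2 x]⟩

theorem IsTest.translate {φ : ℝ → ℝ} (h : IsTest φ) (s : ℝ) : IsTest fun x => φ (x - s) := by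
  refine ⟨h.1.comp (contDiff_id.sub contDiff_const), fun x => ?_⟩
  simpa [add_sub_right_comm] using h.2 (x - s)

theorem isTest_cos (k : ℤ) : IsTest fun x => Real.cos (k * x) := by
  refine ⟨Real.contDiff_cos.comp (contDiff_const.mul contDiff_id), fun x => ?_⟩
  simp [mul_add]

theorem isTest_sin (k : ℤ) : IsTest fun x => Real.sin (k * x) := by
  refine ⟨Real.contDiff_sin.comp (contDiff_const.mul contDiff_id), fun x => ?_⟩
  simp [mul_add]

theorem toL2_sub {φ ψ : ℝ → ℝ} (h : IsTest φ) (k : IsTest ψ) :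
    (h.sub k).toL2 = h.toL2 - k.toL2 := rfl

theorem toL2_const_mul {φ : ℝ → ℝ} (h : IsTest φ) (c : ℝ) :
    (h.const_mul c).toL2 = c • h.toL2 := rfl

theorem toL2_congr {φ ψ : ℝ → ℝ} (h : IsTest φ) (k : IsTest ψ) (e : ∀ x, φ x = ψ x) :
    h.toL2 = k.toL2 := by
  obtain rfl : φ = ψ := funext e
  rfl

theorem integral_cell (f : ℝ → ℝ) : ∫ x, f x ∂cell = ∫ x in (0 : ℝ)..(2 * Real.pi), f x := by
  rw [intervalIntegral.integral_of_le Real.two_pi_pos.le]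

theorem cell_univ : cell.real univ = 2 * Real.pi := by
  simp [cell, Real.pi_nonneg]

theorem IsTest.integral_deriv {φ : ℝ → ℝ} (h : IsTest φ) : ∫ x, _root_.deriv φ x ∂cell = 0 := by
  rw [integral_cell, intervalIntegral.integral_deriv_eq_sub (fun x _ => h.differentiable x)
    (h.deriv.continuous.intervalIntegrable _ _)]
  have := h.2 0
  simp only [zero_add] at this
  rw [this, sub_self]

theorem deriv_mul_test {φ ψ : ℝ → ℝ} (h : IsTest φ) (k : IsTest ψ) (x : ℝ) :
    deriv (fun x => φ x * ψ x) x = deriv φ x * ψ x + φ x * deriv ψ x :=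
  ((h.hasDerivAt x).mul (k.hasDerivAt x)).deriv

theorem integral_mul_deriv {φ ψ : ℝ → ℝ} (h : IsTest φ) (k : IsTest ψ) :
    ∫ x, φ x * deriv ψ x ∂cell = -∫ x, deriv φ x * ψ x ∂cell := by
  have := (h.mul k).integral_deriv
  simp_rw [deriv_mul_test h k] at this
  rw [integral_add ((h.deriv.mul k).memLp 1 |>.integrable le_rfl)
    ((h.mul k.deriv).memLp 1 |>.integrable le_rfl)] at this
  linarith

/-! ### Weak derivatives on the circle. -/

theorem hasWeakDeriv_iff {f g : L2} : HasWeakDeriv f g ↔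
    ∀ φ : ℝ → ℝ, ∀ h : IsTest φ, ⟪f, h.deriv.toL2⟫ = -⟪g, h.toL2⟫ := by
  simp only [HasWeakDeriv, inner_toL2]

theorem HasWeakDeriv.inner {f g : L2} (w : HasWeakDeriv f g) {φ : ℝ → ℝ} (h : IsTest φ) :
    ⟪f, h.deriv.toL2⟫ = -⟪g, h.toL2⟫ := hasWeakDeriv_iff.1 w φ h

theorem IsTest.hasWeakDeriv {φ : ℝ → ℝ} (h : IsTest φ) : HasWeakDeriv h.toL2 h.deriv.toL2 := by
  rw [hasWeakDeriv_iff]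
  intro ψ k
  rw [inner_toL2_toL2, inner_toL2_toL2, integral_mul_deriv h k]

theorem HasWeakDeriv.sub {f g f' g' : L2} (w : HasWeakDeriv f g) (w' : HasWeakDeriv f' g') :
    HasWeakDeriv (f - f') (g - g') := by
  rw [hasWeakDeriv_iff] at *
  intro φ h
  rw [inner_sub_left, inner_sub_left, w φ h, w' φ h]
  ring

/-- The constant function `1`. -/
def one : L2 := (isTest_const 1).toL2

theorem inner_one (f : L2) : ⟪f, one⟫ = ∫ x, f x ∂cell := by
  rw [one, inner_toL2]
  simp

theorem HasWeakDeriv.mean_zero {f g : L2} (w : HasWeakDeriv f g) : ⟪g, one⟫ = 0 := by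
  have := w.inner (isTest_const 1)
  rw [← one, toL2_congr (isTest_const 1).deriv (isTest_const 0) (fun x => by simp),
    inner_toL2] at this
  simpa using this.symm

theorem norm_one_sq : ‖one‖ ^ 2 = 2 * Real.pi := by
  rw [← real_inner_self_eq_norm_sq, one, inner_toL2_toL2]
  simp [Real.pi_nonneg]

/-- A mean-zero test function as an element of `Ḣ²`. -/
def IsTest.toHDot2 {φ : ℝ → ℝ} (h : IsTest φ) (h0 : ∫ x, φ x ∂cell = 0) : HDot2 where
  val := h.toL2
  d1 := h.deriv.toL2
  d2 := h.deriv.deriv.toL2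
  hasWeakDeriv_val := h.hasWeakDeriv
  hasWeakDeriv_d1 := h.deriv.hasWeakDeriv
  mean_zero := by rw [integral_congr_ae h.coeFn_toL2, h0]

instance : Sub HDot2 where
  sub f g :=
    { val := f.val - g.val
      d1 := f.d1 - g.d1
      d2 := f.d2 - g.d2
      hasWeakDeriv_val := f.hasWeakDeriv_val.sub g.hasWeakDeriv_val
      hasWeakDeriv_d1 := f.hasWeakDeriv_d1.sub g.hasWeakDeriv_d1
      mean_zero := by
        rw [← inner_one, inner_sub_left, inner_one, inner_one, f.mean_zero, g.mean_zero, sub_self] }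

theorem HDot2.sub_val (f g : HDot2) : (f - g).val = f.val - g.val := rfl
theorem HDot2.sub_d1 (f g : HDot2) : (f - g).d1 = f.d1 - g.d1 := rfl
theorem HDot2.sub_d2 (f g : HDot2) : (f - g).d2 = f.d2 - g.d2 := rfl

/-! ### Fourier coefficients -/

/-- The Fourier coefficient `∫₀^{2π} f(x) e^{-ikx} dx`. -/
def coeff (k : ℤ) (f : L2) : ℂ := ⟨⟪f, (isTest_cos k).toL2⟫, -⟪f, (isTest_sin k).toL2⟫⟩

theorem fourierCoeffOn_eq_coeff (k : ℤ) (f : L2) :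
    fourierCoeffOn Real.two_pi_pos (fun x => (f x : ℂ)) k
      = ((1 / (2 * Real.pi) : ℝ) : ℂ) * coeff k f := by
  have key : ∫ x in (0 : ℝ)..(2 * Real.pi),
      fourier (-k) (x : AddCircle (2 * Real.pi - 0)) • (f x : ℂ) = coeff k f := by
    rw [intervalIntegral.integral_of_le Real.two_pi_pos.le]
    have h1 : ∀ x : ℝ, fourier (-k) (x : AddCircle (2 * Real.pi - 0)) • (f x : ℂ)
        = ((f x * Real.cos (k * x) : ℝ) : ℂ) - ((f x * Real.sin (k * x) : ℝ) : ℂ) * Complex.I := by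
      intro x
      rw [fourier_coe_apply, smul_eq_mul]
      have h2 : (2 * Real.pi * Complex.I * ((-k : ℤ) : ℂ) * x / ((2 * Real.pi - 0 : ℝ) : ℂ))
          = ((-(k * x) : ℝ) : ℂ) * Complex.I := by
        have : (Real.pi : ℂ) ≠ 0 := by exact_mod_cast Real.pi_ne_zero
        push_cast
        rw [sub_zero]
        field_simp
      rw [h2, Complex.exp_mul_I, ← Complex.ofReal_cos, ← Complex.ofReal_sin, Real.cos_neg,
        Real.sin_neg]
      push_cast
      ring
    simp_rw [h1]
    rw [integral_sub (integrable_mul_test f (isTest_cos k)).ofReal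
      ((integrable_mul_test f (isTest_sin k)).ofReal.mul_const _), integral_mul_const]
    rw [integral_complex_ofReal, integral_complex_ofReal, coeff, inner_toL2, inner_toL2]
    apply Complex.ext <;> simp
  rw [fourierCoeffOn_eq_integral, key, sub_zero]
  simp

theorem hasSum_coeff_sq (f : L2) :
    HasSum (fun k : ℤ => ‖coeff k f‖ ^ 2) (2 * Real.pi * ‖f‖ ^ 2) := by
  have h := hasSum_sq_fourierCoeffOn Real.two_pi_pos (Lp.memLp f).ofReal
  have e : (2 * Real.pi - 0)⁻¹ • ∫ x in (0 : ℝ)..(2 * Real.pi), ‖((f x : ℝ) : ℂ)‖ ^ 2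
      = (2 * Real.pi)⁻¹ * ‖f‖ ^ 2 := by
    rw [norm_sq_eq_integral, integral_cell, sub_zero, smul_eq_mul]
    simp
  have h' : HasSum (fun k : ℤ => (2 * Real.pi) ^ 2 * ‖fourierCoeffOn Real.two_pi_pos
      (fun x => ((f x : ℝ) : ℂ)) k‖ ^ 2) ((2 * Real.pi) ^ 2 * ((2 * Real.pi)⁻¹ * ‖f‖ ^ 2)) := by
    rw [← e]
    exact h.mul_left _
  have e1 : (fun k : ℤ => ‖coeff k f‖ ^ 2) = fun k : ℤ => (2 * Real.pi) ^ 2 *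
      ‖fourierCoeffOn Real.two_pi_pos (fun x => ((f x : ℝ) : ℂ)) k‖ ^ 2 := by
    funext k
    rw [fourierCoeffOn_eq_coeff, norm_mul, Complex.norm_real, Real.norm_eq_abs,
      abs_of_pos (by positivity)]
    field_simp
  have e2 : 2 * Real.pi * ‖f‖ ^ 2 = (2 * Real.pi) ^ 2 * ((2 * Real.pi)⁻¹ * ‖f‖ ^ 2) := by
    field_simp
  rw [e1, e2]
  exact h'

/-- Sines and cosines are test functions, so all Fourier coefficients vanish and Parseval applies.
-/
theorem eq_zero_of_forall_test {f : L2} (h : ∀ φ : ℝ → ℝ, ∀ h : IsTest φ, ⟪f, h.toL2⟫ = 0) :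
    f = 0 := by
  have h0 : ∀ k, coeff k f = 0 := fun k => by
    simp [coeff, h _ (isTest_cos k), h _ (isTest_sin k), Complex.ext_iff]
  have := (hasSum_coeff_sq f).unique
    (show HasSum (fun k : ℤ => ‖coeff k f‖ ^ 2) 0 by simp [h0, hasSum_zero])
  have hp := Real.pi_pos
  have : ‖f‖ ^ 2 = 0 := by nlinarith
  simpa using this

theorem deriv_cos_int (k : ℤ) (x : ℝ) :
    deriv (fun x => Real.cos (k * x)) x = -(k : ℝ) * Real.sin (k * x) := by
  have := ((hasDerivAt_id x).const_mul (k : ℝ)).cos.deriv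
  simp only [id, mul_one] at this
  rw [this]; ring

theorem deriv_sin_int (k : ℤ) (x : ℝ) :
    deriv (fun x => Real.sin (k * x)) x = (k : ℝ) * Real.cos (k * x) := by
  have := ((hasDerivAt_id x).const_mul (k : ℝ)).sin.deriv
  simp only [id, mul_one] at this
  rw [this]; ring

theorem toL2_deriv_cos (k : ℤ) :
    (isTest_cos k).deriv.toL2 = (-(k : ℝ)) • (isTest_sin k).toL2 := by
  rw [← toL2_const_mul]
  exact toL2_congr _ _ (deriv_cos_int k)

theorem toL2_deriv_sin (k : ℤ) :
    (isTest_sin k).deriv.toL2 = (k : ℝ) • (isTest_cos k).toL2 := by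
  rw [← toL2_const_mul]
  exact toL2_congr _ _ (deriv_sin_int k)

theorem HasWeakDeriv.coeff {f g : L2} (w : HasWeakDeriv f g) (k : ℤ) :
    coeff k g = k * Complex.I * coeff k f := by
  have h1 := w.inner (isTest_cos k)
  have h2 := w.inner (isTest_sin k)
  rw [toL2_deriv_cos, inner_smul_right] at h1
  rw [toL2_deriv_sin, inner_smul_right] at h2
  apply Complex.ext <;> simp [KSSystem.coeff] <;> linarith

theorem HasWeakDeriv.norm_coeff {f g : L2} (w : HasWeakDeriv f g) (k : ℤ) :
    ‖KSSystem.coeff k g‖ = |(k : ℝ)| * ‖KSSystem.coeff k f‖ := by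
  rw [w.coeff]
  simp

theorem coeff_zero_of_mean_zero {f : L2} (h : ⟪f, one⟫ = 0) : coeff 0 f = 0 := by
  have h1 : (isTest_cos 0).toL2 = one := toL2_congr _ _ (by simp)
  have h2 : ⟪f, (isTest_sin 0).toL2⟫ = 0 := by simp [inner_toL2]
  rw [coeff, h1, h2, h, neg_zero]
  rfl

/-- Differentiation multiplies the `k`-th coefficient by `ik`; only `k = 0` could lose size, and
that mode is absent. The constant is `1` because the period is `2π`. -/
theorem HasWeakDeriv.poincare {f g : L2} (w : HasWeakDeriv f g) (h : ⟪f, one⟫ = 0) :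
    ‖f‖ ≤ ‖g‖ := by
  have := hasSum_le (fun k => ?_) (hasSum_coeff_sq f) (hasSum_coeff_sq g)
  · have hp := Real.pi_pos
    refine le_of_sq_le_sq ?_ (norm_nonneg _)
    exact le_of_mul_le_mul_left this Real.two_pi_pos
  · rw [w.norm_coeff]
    rcases eq_or_ne k 0 with rfl | hk
    · simp [coeff_zero_of_mean_zero h]
    · have : (1 : ℝ) ≤ |(k : ℝ)| := by exact_mod_cast Int.one_le_abs hk
      gcongr
      exact le_mul_of_one_le_left (norm_nonneg _) this

/-! ### Density of test functions -/

/-- The subspace of `L²` formed by the test functions. -/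
def testSubmodule : Submodule ℝ L2 where
  carrier := {f | ∃ φ : ℝ → ℝ, ∃ h : IsTest φ, h.toL2 = f}
  add_mem' := by
    rintro _ _ ⟨φ, h, rfl⟩ ⟨ψ, k, rfl⟩
    exact ⟨_, h.add k, rfl⟩
  zero_mem' := ⟨_, (isTest_const 0), rfl⟩
  smul_mem' := by
    rintro c _ ⟨φ, h, rfl⟩
    exact ⟨_, h.const_mul c, rfl⟩

theorem testSubmodule_dense : testSubmodule.topologicalClosure = ⊤ := by
  rw [Submodule.topologicalClosure_eq_top_iff, Submodule.eq_bot_iff]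
  intro f hf
  refine eq_zero_of_forall_test fun φ h => ?_
  rw [real_inner_comm]
  exact hf _ ⟨φ, h, rfl⟩

theorem integral_eq_inner_one {φ : ℝ → ℝ} (h : IsTest φ) : ∫ x, φ x ∂cell = ⟪h.toL2, one⟫ := by
  rw [inner_one]
  exact (integral_congr_ae h.coeFn_toL2).symm

theorem exists_test_tendsto {f : L2} (hf : ⟪f, one⟫ = 0) :
    ∃ (φ : ℕ → ℝ → ℝ) (h : ∀ n, IsTest (φ n)), (∀ n, ∫ x, φ n x ∂cell = 0) ∧
      Tendsto (fun n => (h n).toL2) atTop (𝓝 f) := by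
  have hmem : f ∈ closure (testSubmodule : Set L2) := by
    rw [← Submodule.topologicalClosure_coe, testSubmodule_dense]
    trivial
  obtain ⟨g, hg, hlim⟩ := mem_closure_iff_seq_limit.1 hmem
  choose φ h hφ using hg
  let c : ℕ → ℝ := fun n => ⟪g n, one⟫ / (2 * Real.pi)
  have hs : ∀ n, ((h n).sub (isTest_const (c n))).toL2 = g n - c n • one := by
    intro n
    rw [toL2_sub (h n) (isTest_const (c n)), hφ, one, ← toL2_const_mul]
    congr 1
    exact toL2_congr (isTest_const _) ((isTest_const 1).const_mul _) (by simp)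
  refine ⟨_, fun n => (h n).sub (isTest_const (c n)), fun n => ?_, ?_⟩
  · rw [integral_eq_inner_one ((h n).sub (isTest_const (c n))), hs, inner_sub_left,
      real_inner_smul_left, real_inner_self_eq_norm_sq, norm_one_sq]
    simp only [c]
    field_simp
    simp
  · simp_rw [hs]
    have h1 : Tendsto c atTop (𝓝 (⟪f, one⟫ / (2 * Real.pi))) :=
      ((hlim.inner tendsto_const_nhds)).div_const _
    rw [hf, zero_div] at h1
    simpa using hlim.sub (h1.smul_const one)

theorem IsTest.exists_primitive {φ : ℝ → ℝ} (h : IsTest φ) (h0 : ∫ x, φ x ∂cell = 0) :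
    ∃ ψ : ℝ → ℝ, IsTest ψ ∧ ∫ x, ψ x ∂cell = 0 ∧ _root_.deriv ψ = φ := by
  let Ψ : ℝ → ℝ := fun x => ∫ t in (0 : ℝ)..x, φ t
  have hd : ∀ x, HasDerivAt Ψ (φ x) x := fun x =>
    (h.continuous.integral_hasStrictDerivAt 0 x).hasDerivAt
  have hΨ : IsTest Ψ := by
    constructor
    · rw [contDiff_infty_iff_deriv]
      refine ⟨fun x => (hd x).differentiableAt, ?_⟩
      rw [funext fun x => (hd x).deriv]
      exact h.1
    · intro x
      have h1 : ∫ t in x..(x + 2 * Real.pi), φ t = 0 := by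
        rw [h.2.intervalIntegral_add_eq x 0, zero_add, ← integral_cell, h0]
      simp only [Ψ]
      rw [← intervalIntegral.integral_add_adjacent_intervals (b := x)
        (h.continuous.intervalIntegrable _ _) (h.continuous.intervalIntegrable _ _), h1, add_zero]
  let c : ℝ := (∫ x, Ψ x ∂cell) / (2 * Real.pi)
  refine ⟨fun x => Ψ x - c, hΨ.sub (isTest_const c), ?_, ?_⟩
  · rw [integral_sub ((hΨ.memLp 1).integrable le_rfl) (integrable_const _), integral_const,
      cell_univ]
    simp only [c, smul_eq_mul]
    field_simp
    simp
  · funext x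
    rw [deriv_sub_const, (hd x).deriv]

theorem inner_one_val (f : HDot2) : ⟪f.val, one⟫ = 0 := by rw [inner_one, f.mean_zero]

theorem HDot2.norm_val_le (f : HDot2) : ‖f.val‖ ≤ ‖f.d1‖ :=
  f.hasWeakDeriv_val.poincare (inner_one_val f)

theorem HDot2.norm_d1_le (f : HDot2) : ‖f.d1‖ ≤ ‖f.d2‖ :=
  f.hasWeakDeriv_d1.poincare f.hasWeakDeriv_val.mean_zero

/-- Mean-zero test functions are dense in `Ḣ²`. -/
theorem HDot2.exists_tendsto (f : HDot2) :
    ∃ (φ : ℕ → ℝ → ℝ) (h : ∀ n, IsTest (φ n)) (h0 : ∀ n, ∫ x, φ n x ∂cell = 0),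
      Tendsto (fun n => ((h n).toHDot2 (h0 n)).val) atTop (𝓝 f.val) ∧
      Tendsto (fun n => ((h n).toHDot2 (h0 n)).d1) atTop (𝓝 f.d1) ∧
      Tendsto (fun n => ((h n).toHDot2 (h0 n)).d2) atTop (𝓝 f.d2) := by
  -- Approximate the second derivative and integrate twice with zero mean; Poincaré carries the
  -- convergence down to the lower derivatives.
  obtain ⟨φ, h, h0, hlim⟩ := exists_test_tendsto f.hasWeakDeriv_d1.mean_zero
  choose ψ k k0 hψ using fun n => (h n).exists_primitive (h0 n)
  choose χ l l0 hχ using fun n => (k n).exists_primitive (k0 n)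
  have e2 : ∀ n, ((l n).toHDot2 (l0 n)).d2 = (h n).toL2 := fun n =>
    toL2_congr (l n).deriv.deriv (h n) fun x => by rw [hχ, hψ]
  have t2 : Tendsto (fun n => ((l n).toHDot2 (l0 n)).d2) atTop (𝓝 f.d2) := by simpa only [e2]
  have t1 : Tendsto (fun n => ((l n).toHDot2 (l0 n)).d1) atTop (𝓝 f.d1) := by
    rw [tendsto_iff_norm_sub_tendsto_zero] at t2 ⊢
    exact squeeze_zero (fun _ => norm_nonneg _)
      (fun n => ((l n).toHDot2 (l0 n) - f).norm_d1_le) t2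
  have t0 : Tendsto (fun n => ((l n).toHDot2 (l0 n)).val) atTop (𝓝 f.val) := by
    rw [tendsto_iff_norm_sub_tendsto_zero] at t1 ⊢
    exact squeeze_zero (fun _ => norm_nonneg _)
      (fun n => ((l n).toHDot2 (l0 n) - f).norm_val_le) t1
  exact ⟨χ, l, l0, t0, t1, t2⟩

/-! ### Sobolev embedding and the quadratic term -/

theorem integral_abs_le (f : L2) : ∫ x, |f x| ∂cell ≤ ‖one‖ * ‖f‖ := by
  have h : ∫ x, |f x| ∂cell = ⟪|f|, one⟫ := by
    rw [inner_one]
    exact integral_congr_ae ((Lp.coeFn_abs f).mono fun x hx => hx.symm)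
  rw [h, mul_comm, ← norm_abs_eq_norm f]
  exact real_inner_le_norm _ _

/-- Averaging `φ x - φ y` over `y` returns `φ x`, and each difference is at most the `L¹` norm of
the derivative, hence Cauchy–Schwarz. -/
theorem IsTest.abs_le_of_mean_zero {φ : ℝ → ℝ} (h : IsTest φ) (h0 : ∫ x, φ x ∂cell = 0) (x : ℝ) :
    |φ x| ≤ ‖one‖ * ‖h.deriv.toL2‖ := by
  have hpi := Real.two_pi_pos
  obtain ⟨x', hx', hxx'⟩ := h.2.exists_mem_Ico₀ hpi x
  rw [hxx']
  have hI : ∫ t, |_root_.deriv φ t| ∂cell ≤ ‖one‖ * ‖h.deriv.toL2‖ := by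
    refine le_trans (le_of_eq ?_) (integral_abs_le _)
    exact integral_congr_ae (h.deriv.coeFn_toL2.mono fun x hx => by simp only [hx])
  have hy : ∀ y ∈ Ioc 0 (2 * Real.pi), |φ x' - φ y| ≤ ‖one‖ * ‖h.deriv.toL2‖ := by
    intro y hy
    refine le_trans ?_ hI
    rw [← intervalIntegral.integral_deriv_eq_sub (a := y) (fun x _ => h.differentiable x)
      (h.deriv.continuous.intervalIntegrable _ _)]
    rw [← Real.norm_eq_abs]
    refine intervalIntegral.norm_integral_le_integral_norm_uIoc.trans ?_
    refine setIntegral_mono_set ?_ (ae_of_all _ fun _ => abs_nonneg _) ?_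
    · exact ((h.deriv.memLp 1).integrable le_rfl).abs
    · have hs : uIoc y x' ⊆ Ioc 0 (2 * Real.pi) := fun z hz => by
        rw [uIoc, mem_Ioc] at hz
        exact ⟨(le_min hy.1.le hx'.1).trans_lt hz.1, hz.2.trans (max_le hy.2 hx'.2.le)⟩
      exact LE.le.eventuallyLE hs
  have h1 : ∫ y, (φ x' - φ y) ∂cell = 2 * Real.pi * φ x' := by
    rw [integral_sub (integrable_const _) ((h.memLp 1).integrable le_rfl), h0, integral_const,
      cell_univ, sub_zero, smul_eq_mul]
  have h2 : |∫ y, (φ x' - φ y) ∂cell| ≤ (‖one‖ * ‖h.deriv.toL2‖) * cell.real univ := by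
    rw [← Real.norm_eq_abs]
    exact norm_integral_le_of_norm_le_const
      ((ae_restrict_mem measurableSet_Ioc).mono fun y hy' => hy y hy')
  rw [h1, cell_univ, abs_mul, abs_of_pos hpi, mul_comm] at h2
  exact le_of_mul_le_mul_right h2 hpi

theorem HDot2.ae_abs_le (f : HDot2) : ∀ᵐ x ∂cell, |f.val x| ≤ ‖one‖ * ‖f.d1‖ := by
  obtain ⟨φ, h, h0, t0, t1, -⟩ := f.exists_tendsto
  obtain ⟨ns, hns, hae⟩ := (tendstoInMeasure_of_tendsto_Lp t0).exists_seq_tendsto_ae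
  have hall : ∀ᵐ x ∂cell, ∀ n, (h n).toL2 x = φ n x := ae_all_iff.2 fun n => (h n).coeFn_toL2
  filter_upwards [hae, hall] with x hx hx'
  refine le_of_tendsto_of_tendsto hx.abs
    ((t1.norm.const_mul ‖one‖).comp hns.tendsto_atTop) (Eventually.of_forall fun n => ?_)
  have : ((h (ns n)).toHDot2 (h0 (ns n))).val x = φ (ns n) x := hx' (ns n)
  simp only [Function.comp, this]
  exact (h (ns n)).abs_le_of_mean_zero (h0 (ns n)) x

theorem HDot2.memLp_top (f : HDot2) : MemLp f.val ⊤ cell :=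
  memLp_top_of_bound (Lp.aestronglyMeasurable _) _ f.ae_abs_le

theorem HDot2.eLpNorm_top_le (f : HDot2) :
    eLpNorm f.val ⊤ cell ≤ ENNReal.ofReal (‖one‖ * ‖f.d1‖) := by
  rw [eLpNorm_exponent_top]
  exact eLpNormEssSup_le_of_ae_bound f.ae_abs_le

theorem HDot2.memLp_sq (f : HDot2) : MemLp (fun x => f.val x ^ 2) 2 cell := by
  refine MemLp.of_bound ((Lp.aestronglyMeasurable f.val).pow 2) ((‖one‖ * ‖f.d1‖) ^ 2) ?_
  filter_upwards [f.ae_abs_le] with x hx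
  rw [norm_pow, Real.norm_eq_abs]
  exact pow_le_pow_left₀ (abs_nonneg _) hx 2

/-- The square of a function in `Ḣ²`, as an element of `L²`. -/
def HDot2.sq (f : HDot2) : L2 := f.memLp_sq.toLp _

theorem HDot2.coeFn_sq (f : HDot2) : f.sq =ᵐ[cell] fun x => f.val x ^ 2 := f.memLp_sq.coeFn_toLp

/-- Factor `f² - g² = (f - g)(f + g)` and put the Sobolev bound on the first factor. This makes
squaring continuous, which lets the nonlinear identities pass to the limit from test functions. -/
theorem HDot2.norm_sq_sub_sq_le (f g : HDot2) :
    ‖f.sq - g.sq‖ ≤ ‖one‖ * ‖f.d1 - g.d1‖ * ‖f.val + g.val‖ := by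
  refine Lp.norm_le_mul_norm_of_ae_le_mul ?_
  filter_upwards [f.coeFn_sq, g.coeFn_sq, Lp.coeFn_sub f.sq g.sq, Lp.coeFn_add f.val g.val,
    (f - g).ae_abs_le, Lp.coeFn_sub f.val g.val] with x h1 h2 h3 h4 h5 h6
  rw [h3, h4, Pi.sub_apply, Pi.add_apply, h1, h2, sq_sub_sq, norm_mul, mul_comm]
  gcongr
  rwa [HDot2.sub_val, h6] at h5

theorem tendsto_sq {ι : Type*} {l : Filter ι} {f : ι → HDot2} {g : HDot2}
    (h0 : Tendsto (fun i => (f i).val) l (𝓝 g.val)) (h1 : Tendsto (fun i => (f i).d1) l (𝓝 g.d1)) :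
    Tendsto (fun i => (f i).sq) l (𝓝 g.sq) := by
  rw [tendsto_iff_norm_sub_tendsto_zero]
  refine squeeze_zero (fun _ => norm_nonneg _) (fun i => (f i).norm_sq_sub_sq_le g) ?_
  have := ((tendsto_iff_norm_sub_tendsto_zero.1 h1).const_mul ‖one‖).mul
    (h0.add_const g.val).norm
  simpa using this

theorem HDot2.inner_sq_toL2 (f : HDot2) {φ : ℝ → ℝ} (h : IsTest φ) :
    ⟪f.sq, h.toL2⟫ = ∫ x, f.val x ^ 2 * φ x ∂cell := by
  rw [inner_toL2]
  exact integral_congr_ae (f.coeFn_sq.mono fun x hx => by simp only [hx])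

theorem IsTest.sq_toHDot2 {φ : ℝ → ℝ} (h : IsTest φ) (h0 : ∫ x, φ x ∂cell = 0) :
    (h.toHDot2 h0).sq = (h.pow 2).toL2 := by
  refine Lp.ext ?_
  filter_upwards [(h.toHDot2 h0).coeFn_sq, (h.pow 2).coeFn_toL2, h.coeFn_toL2] with x h1 h2 h3
  rw [h1, h2, ← h3]
  rfl

/-- The integrand is `(f³)' / 3`, a periodic total derivative. This is why the nonlinearity does no
work in the plain energy balance. -/
theorem HDot2.inner_sq_d1 (f : HDot2) : ⟪f.sq, f.d1⟫ = 0 := by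
  obtain ⟨φ, h, h0, t0, t1, -⟩ := f.exists_tendsto
  refine tendsto_nhds_unique ((tendsto_sq t0 t1).inner t1) ?_
  refine tendsto_const_nhds.congr fun n => ?_
  rw [(h n).sq_toHDot2]
  change 0 = ⟪((h n).pow 2).toL2, (h n).deriv.toL2⟫
  rw [inner_toL2_toL2]
  have h3 := ((h n).pow 3).integral_deriv
  have : ∀ x, deriv (fun x => φ n x ^ 3) x = 3 * (φ n x ^ 2 * deriv (φ n) x) := fun x => by
    rw [(((h n).hasDerivAt x).fun_pow 3).deriv]
    push_cast
    ring
  simp_rw [this, integral_const_mul] at h3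
  linarith

theorem HDot2.inner_val_d2 (f g : HDot2) : ⟪f.val, g.d2⟫ = -⟪f.d1, g.d1⟫ := by
  obtain ⟨φ, h, h0, -, t1, t2⟩ := g.exists_tendsto
  refine tendsto_nhds_unique (tendsto_const_nhds.inner t2) ?_
  refine (tendsto_const_nhds.inner t1).neg.congr fun n => ?_
  exact (f.hasWeakDeriv_val.inner (h n).deriv).symm

theorem HDot2.norm_d1_sq_le (f : HDot2) : ‖f.d1‖ ^ 2 ≤ ‖f.val‖ * ‖f.d2‖ := by
  have h := f.inner_val_d2 f
  rw [real_inner_self_eq_norm_sq] at h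
  have := abs_real_inner_le_norm f.val f.d2
  rw [h, abs_neg, abs_of_nonneg (sq_nonneg _)] at this
  exact this

theorem HDot2.sq_integral_le (f : HDot2) {φ : ℝ → ℝ} (h : IsTest φ) {B : ℝ}
    (hB : ∀ x, |φ x| ≤ B) : |⟪f.sq, h.toL2⟫| ≤ B * ‖f.val‖ ^ 2 := by
  rw [f.inner_sq_toL2, norm_sq_eq_integral, ← integral_const_mul, ← Real.norm_eq_abs]
  refine norm_integral_le_of_norm_le ((integrable_sq _).const_mul _) (ae_of_all _ fun x => ?_)
  rw [norm_mul, Real.norm_eq_abs, Real.norm_eq_abs, abs_of_nonneg (sq_nonneg _), mul_comm]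
  gcongr
  exact hB x

/-! ### Solutions as curves in `L²` -/

/-- The terms of lower order of the equation, written as a flux. -/
def flux (α : ℝ) (u w : HDot2) : L2 := u.d1 + (1 / 2 : ℝ) • u.sq + α • w.d1

/-- A continuous curve with values in `Ḣ²`. -/
structure IsCurve (u : ℝ → HDot2) : Prop where
  val : Continuous fun t => (u t).val
  d1 : Continuous fun t => (u t).d1
  d2 : Continuous fun t => (u t).d2

theorem IsCurve.sq {u : ℝ → HDot2} (hu : IsCurve u) : Continuous fun t => (u t).sq :=
  continuous_iff_continuousAt.2 fun _ => tendsto_sq hu.val.continuousAt hu.d1.continuousAt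

theorem IsCurve.flux {u w : ℝ → HDot2} (hu : IsCurve u) (hw : IsCurve w) (α : ℝ) :
    Continuous fun t => flux α (u t) (w t) :=
  (hu.d1.add (hu.sq.fun_const_smul (1 / 2 : ℝ))).add (hw.d1.fun_const_smul α)

/-- The curve `u` satisfies the equation with coupling to `w` in `L²`-pairing form on `[0,T]`. -/
structure IsTrajectory (ν α T : ℝ) (u w : ℝ → HDot2) : Prop where
  left : IsCurve u
  right : IsCurve w
  equation : ∀ φ : ℝ → ℝ, ∀ h : IsTest φ, ∀ t ∈ Icc 0 T,
    ⟪(u t).val - (u 0).val, h.toL2⟫ = ⟪∫ s in (0 : ℝ)..t, (-ν) • (u s).d2, h.deriv.deriv.toL2⟫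
      + ⟪∫ s in (0 : ℝ)..t, flux α (u s) (w s), h.deriv.toL2⟫

theorem weakRHS_eq (ν α : ℝ) (u w : HDot2) {φ : ℝ → ℝ} (h : IsTest φ) :
    weakRHS ν α u.val w.val φ
      = ⟪(-ν) • u.d2, h.deriv.deriv.toL2⟫ + ⟪flux α u w, h.deriv.toL2⟫ := by
  have e2 : iteratedDeriv 2 φ = deriv (deriv φ) := by
    rw [iteratedDeriv_eq_iterate]; rfl
  have e4 : iteratedDeriv 4 φ = deriv (deriv (deriv (deriv φ))) := by
    rw [iteratedDeriv_eq_iterate]; rfl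
  have i4 := integrable_mul_test u.val h.deriv.deriv.deriv.deriv
  have i2 := integrable_mul_test u.val h.deriv.deriv
  have iw := integrable_mul_test w.val h.deriv.deriv
  have iq : Integrable (fun x => u.val x ^ 2 * deriv φ x) cell :=
    (integrable_mul_test u.sq h.deriv).congr (u.coeFn_sq.mono fun x hx => by simp only [hx])
  have e : ∀ x, -ν * u.val x * iteratedDeriv 4 φ x - u.val x * iteratedDeriv 2 φ x
      + (u.val x) ^ 2 / 2 * deriv φ x - α * w.val x * iteratedDeriv 2 φ x
      = -ν * (u.val x * deriv (deriv (deriv (deriv φ))) x) - u.val x * deriv (deriv φ) x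
        + 1 / 2 * (u.val x ^ 2 * deriv φ x) - α * (w.val x * deriv (deriv φ) x) := fun x => by
    rw [e2, e4]; ring
  have j1 : Integrable (fun x => -ν * (u.val x * deriv (deriv (deriv (deriv φ))) x)
      - u.val x * deriv (deriv φ) x) cell := (i4.const_mul _).sub i2
  have j2 : Integrable (fun x => -ν * (u.val x * deriv (deriv (deriv (deriv φ))) x)
      - u.val x * deriv (deriv φ) x + 1 / 2 * (u.val x ^ 2 * deriv φ x)) cell :=
    j1.add (iq.const_mul _)
  rw [weakRHS]
  simp_rw [e]
  rw [integral_sub j2 (iw.const_mul _), integral_add j1 (iq.const_mul _),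
    integral_sub (i4.const_mul _) i2,
    integral_const_mul, integral_const_mul, integral_const_mul,
    ← inner_toL2 _ h.deriv.deriv.deriv.deriv, ← inner_toL2 _ h.deriv.deriv,
    ← inner_toL2 _ h.deriv.deriv, ← u.inner_sq_toL2 h.deriv,
    u.hasWeakDeriv_val.inner h.deriv.deriv.deriv, u.hasWeakDeriv_d1.inner h.deriv.deriv,
    u.hasWeakDeriv_val.inner h.deriv, w.hasWeakDeriv_val.inner h.deriv, flux, inner_add_left,
    inner_add_left, real_inner_smul_left, real_inner_smul_left, real_inner_smul_left]
  ring

/-- Extension of a curve on `[0,T]` by its end values. -/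
def extend {T : ℝ} (hT : 0 ≤ T) (u : ℝ → HDot2) (t : ℝ) : HDot2 := u (projIcc 0 T hT t)

theorem extend_eq {T : ℝ} (hT : 0 ≤ T) (u : ℝ → HDot2) {t : ℝ} (ht : t ∈ Icc 0 T) :
    extend hT u t = u t := by rw [extend, projIcc_of_mem hT ht]

theorem ContinuousInH2.isCurve {T : ℝ} (hT : 0 ≤ T) {u : ℝ → HDot2} (h : ContinuousInH2 T u) :
    IsCurve (extend hT u) where
  val := (continuousOn_iff_continuous_domRestrict.1 h.1).comp continuous_projIcc
  d1 := (continuousOn_iff_continuous_domRestrict.1 h.2.1).comp continuous_projIcc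
  d2 := (continuousOn_iff_continuous_domRestrict.1 h.2.2).comp continuous_projIcc

theorem WeakEquation.isTrajectory {ν α T : ℝ} (hT : 0 ≤ T) {u w : ℝ → HDot2}
    (hu : ContinuousInH2 T u) (hw : ContinuousInH2 T w) (h : WeakEquation ν α T u w) :
    IsTrajectory ν α T (extend hT u) (extend hT w) := by
  have hu' := hu.isCurve hT
  have hw' := hw.isCurve hT
  refine ⟨hu', hw', fun φ k t ht => ?_⟩
  have h1 := h φ k t ht
  rw [← inner_toL2 _ k, ← inner_toL2 _ k, ← inner_sub_left] at h1
  rw [extend_eq hT u ht, extend_eq hT u (left_mem_Icc.2 hT), h1]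
  have c1 : Continuous fun s => (-ν) • (extend hT u s).d2 := hu'.d2.fun_const_smul (-ν)
  have c2 := hu'.flux hw' α
  have e1 : ⟪∫ s in (0 : ℝ)..t, (-ν) • (extend hT u s).d2, k.deriv.deriv.toL2⟫
      = ∫ s in (0 : ℝ)..t, ⟪(-ν) • (extend hT u s).d2, k.deriv.deriv.toL2⟫ := by
    simp_rw [real_inner_comm k.deriv.deriv.toL2]
    exact ((innerSL ℝ k.deriv.deriv.toL2).intervalIntegral_comp_comm
      (c1.intervalIntegrable _ _)).symm
  have e2 : ⟪∫ s in (0 : ℝ)..t, KSSystem.flux α (extend hT u s) (extend hT w s), k.deriv.toL2⟫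
      = ∫ s in (0 : ℝ)..t, ⟪KSSystem.flux α (extend hT u s) (extend hT w s), k.deriv.toL2⟫ := by
    simp_rw [real_inner_comm k.deriv.toL2]
    exact ((innerSL ℝ k.deriv.toL2).intervalIntegral_comp_comm
      (c2.intervalIntegrable _ _)).symm
  rw [e1, e2, ← intervalIntegral.integral_add
    ((c1.inner continuous_const).intervalIntegrable _ _)
    ((c2.inner continuous_const).intervalIntegrable _ _)]
  refine intervalIntegral.integral_congr fun s hs => ?_
  rw [uIcc_of_le ht.1] at hs
  have hs' : s ∈ Icc 0 T := ⟨hs.1, hs.2.trans ht.2⟩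
  simp only [extend_eq hT _ hs', weakRHS_eq ν α _ _ k]

namespace IsTrajectory

variable {ν α T : ℝ} {u w : ℝ → HDot2}

/-- The time-integrated equation puts at most two derivatives on the test function, so density
extends it to tests in `Ḣ²`, in particular to the solution itself. -/
theorem inner_sub (h : IsTrajectory ν α T u w) (v : HDot2) {a b : ℝ} (ha : a ∈ Icc 0 T)
    (hb : b ∈ Icc 0 T) :
    ⟪(u b).val - (u a).val, v.val⟫
      = ⟪(∫ s in (0 : ℝ)..b, (-ν) • (u s).d2) - ∫ s in (0 : ℝ)..a, (-ν) • (u s).d2, v.d2⟫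
        + ⟪(∫ s in (0 : ℝ)..b, flux α (u s) (w s)) - ∫ s in (0 : ℝ)..a, flux α (u s) (w s),
            v.d1⟫ := by
  have key : ∀ t ∈ Icc 0 T, ⟪(u t).val - (u 0).val, v.val⟫
      = ⟪∫ s in (0 : ℝ)..t, (-ν) • (u s).d2, v.d2⟫
        + ⟪∫ s in (0 : ℝ)..t, flux α (u s) (w s), v.d1⟫ := by
    intro t ht
    obtain ⟨φ, k, k0, t0, t1, t2⟩ := v.exists_tendsto
    refine tendsto_nhds_unique (tendsto_const_nhds.inner t0) ?_
    exact ((tendsto_const_nhds.inner t2).add (tendsto_const_nhds.inner t1)).congr fun n =>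
      (h.equation _ (k n) t ht).symm
  have hkb := key b hb
  have hka := key a ha
  rw [inner_sub_left] at hka hkb ⊢
  rw [inner_sub_left, inner_sub_left]
  linarith

/-- The curve need not be differentiable in `L²`. The increment of the square is split as increment
paired with `u τ - v` plus increment paired with `u t - v`; both pairings are given by `inner_sub`,
and continuity in `H²` handles the moving factor. -/
theorem hasDerivWithinAt_dist_sq (h : IsTrajectory ν α T u w) (v : HDot2) {t : ℝ}
    (ht : t ∈ Icc 0 T) :
    HasDerivWithinAt (fun τ => ‖(u τ).val - v.val‖ ^ 2)
      (2 * (⟪(-ν) • (u t).d2, (u t).d2 - v.d2⟫ + ⟪flux α (u t) (w t), (u t).d1 - v.d1⟫))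
      (Icc 0 T) t := by
  have hP := ((h.left.d2.fun_const_smul (-ν)).integral_hasStrictDerivAt 0 t).hasDerivAt
  have hQ := ((h.left.flux h.right α).integral_hasStrictDerivAt 0 t).hasDerivAt
  have hP' := hasDerivWithinAt_iff_tendsto_slope.1 (hP.hasDerivWithinAt (s := Icc 0 T))
  have hQ' := hasDerivWithinAt_iff_tendsto_slope.1 (hQ.hasDerivWithinAt (s := Icc 0 T))
  rw [hasDerivWithinAt_iff_tendsto_slope]
  have c2 : Tendsto (fun τ => ((u τ).d2 - v.d2) + ((u t).d2 - v.d2)) (𝓝[Icc 0 T \ {t}] t)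
      (𝓝 (((u t).d2 - v.d2) + ((u t).d2 - v.d2))) :=
    ((h.left.d2.sub continuous_const).add continuous_const).continuousWithinAt
  have c1 : Tendsto (fun τ => ((u τ).d1 - v.d1) + ((u t).d1 - v.d1)) (𝓝[Icc 0 T \ {t}] t)
      (𝓝 (((u t).d1 - v.d1) + ((u t).d1 - v.d1))) :=
    ((h.left.d1.sub continuous_const).add continuous_const).continuousWithinAt
  have hlim := (hP'.inner (𝕜 := ℝ) c2).add (hQ'.inner (𝕜 := ℝ) c1)
  rw [inner_add_right, inner_add_right, ← two_mul, ← two_mul, ← mul_add] at hlim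
  refine hlim.congr' ?_
  filter_upwards [self_mem_nhdsWithin] with τ hτ
  have i1 := h.inner_sub (u τ - v) ht hτ.1
  have i2 := h.inner_sub (u t - v) ht hτ.1
  have e : ‖(u τ).val - v.val‖ ^ 2 - ‖(u t).val - v.val‖ ^ 2
      = ⟪(u τ).val - (u t).val, (u τ - v).val⟫ + ⟪(u τ).val - (u t).val, (u t - v).val⟫ := by
    rw [HDot2.sub_val, HDot2.sub_val, ← inner_add_right, ← real_inner_self_eq_norm_sq,
      ← real_inner_self_eq_norm_sq]
    simp only [inner_add_right, inner_sub_left, inner_sub_right,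
      real_inner_comm (u t).val (u τ).val, real_inner_comm v.val]
    ring
  simp only [slope_def_module, real_inner_smul_left]
  rw [e, i1, i2]
  simp only [HDot2.sub_d1, HDot2.sub_d2, inner_add_right, smul_eq_mul]
  ring

end IsTrajectory

/-! ### The concentrating kernels -/

theorem IsTest.integrable {φ : ℝ → ℝ} (h : IsTest φ) : Integrable φ cell :=
  (h.memLp 1).integrable le_rfl

theorem IsTest.integral_translate {φ : ℝ → ℝ} (h : IsTest φ) (s : ℝ) :
    ∫ x, φ (x - s) ∂cell = ∫ x, φ x ∂cell := by
  rw [integral_cell, integral_cell, intervalIntegral.integral_comp_sub_right]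
  have := h.2.intervalIntegral_add_eq (0 - s) 0
  rwa [zero_add, zero_sub, neg_add_eq_sub, ← zero_sub] at this

/-- The kernel `(1 + cos x)ⁿ`, which concentrates at `0` as `n` grows. -/
def kernel (n : ℕ) (x : ℝ) : ℝ := (1 + Real.cos x) ^ n

theorem isTest_cos_one : IsTest Real.cos :=
  ⟨Real.contDiff_cos, Real.cos_periodic⟩

theorem isTest_sin_one : IsTest Real.sin :=
  ⟨Real.contDiff_sin, Real.sin_periodic⟩

theorem isTest_kernel (n : ℕ) : IsTest (kernel n) := ((isTest_const 1).add isTest_cos_one).pow n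

theorem kernel_nonneg (n : ℕ) (x : ℝ) : 0 ≤ kernel n x :=
  pow_nonneg (by linarith [Real.neg_one_le_cos x]) n

/-- The mass of `kernel n`. -/
def kernelMass (n : ℕ) : ℝ := ∫ x, kernel n x ∂cell

theorem kernelMass_pos (n : ℕ) : 0 < kernelMass n := by
  rw [kernelMass, integral_cell]
  refine intervalIntegral.integral_pos Real.two_pi_pos (isTest_kernel n).continuous.continuousOn
    (fun x _ => kernel_nonneg n x) ⟨0, left_mem_Icc.2 Real.two_pi_pos.le, ?_⟩
  simp [kernel]

/-- The function `kernel n x * sin x` has derivative `kernel - (n + 1) kernel (1 - cos)`, whose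
integral over a period vanishes. Since `1 - cos` measures squared distance to `0`, this quantifies
the concentration. -/
theorem integral_kernel_mul_one_sub_cos {n : ℕ} (hn : n ≠ 0) :
    ∫ x, kernel n x * (1 - Real.cos x) ∂cell = kernelMass n / (n + 1) := by
  have hk := isTest_kernel n
  have hd : ∀ x, deriv (fun x => kernel n x * Real.sin x) x
      = kernel n x - (n + 1) * (kernel n x * (1 - Real.cos x)) := by
    intro x
    have h1 : HasDerivAt (kernel n) (n * (1 + Real.cos x) ^ (n - 1) * (-Real.sin x)) x :=
      ((Real.hasDerivAt_cos x).const_add 1).fun_pow n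
    rw [(h1.fun_mul (Real.hasDerivAt_sin x)).deriv]
    obtain ⟨m, rfl⟩ := Nat.exists_eq_succ_of_ne_zero hn
    simp only [kernel, Nat.succ_eq_add_one, Nat.add_sub_cancel, pow_succ]
    have := Real.sin_sq_add_cos_sq x
    push_cast
    linear_combination (-(m + 1 : ℝ) * (1 + Real.cos x) ^ m) * this
  have h0 := (hk.mul isTest_sin_one).integral_deriv
  simp_rw [hd] at h0
  have hi : Integrable (fun x => kernel n x * (1 - Real.cos x)) cell :=
    (hk.mul ((isTest_const 1).sub isTest_cos_one)).integrable
  rw [integral_sub hk.integrable (hi.const_mul _), integral_const_mul, ← kernelMass] at h0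
  field_simp
  linarith

/-- The Sobolev bound on `φ'` gives a Lipschitz constant in terms of `‖φ''‖`. After moving `x` by
periods to within `π` of `s`, the squared distance is at most `π²/2` times `1 - cos`. -/
theorem IsTest.sq_sub_le {φ : ℝ → ℝ} (h : IsTest φ) (s x : ℝ) :
    (φ x - φ s) ^ 2 ≤ (‖one‖ * ‖h.deriv.deriv.toL2‖) ^ 2 * (Real.pi ^ 2 / 2)
      * (1 - Real.cos (x - s)) := by
  set B := ‖one‖ * ‖h.deriv.deriv.toL2‖
  have hlip : ∀ a b, |φ b - φ a| ≤ B * |b - a| := fun a b =>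
    convex_univ.norm_image_sub_le_of_norm_deriv_le (fun x _ => h.differentiable x)
      (fun x _ => h.deriv.abs_le_of_mean_zero h.integral_deriv x) (mem_univ a) (mem_univ b)
  obtain ⟨n, hn⟩ : ∃ n : ℤ, |x - s - n * (2 * Real.pi)| ≤ Real.pi := by
    refine ⟨toIocDiv Real.two_pi_pos (-Real.pi) (x - s), ?_⟩
    have := toIocMod_mem_Ioc Real.two_pi_pos (-Real.pi) (x - s)
    rw [← self_sub_toIocDiv_mul] at this
    rw [abs_le]
    exact ⟨this.1.le, by linarith [this.2]⟩
  have e1 : φ (x - n * (2 * Real.pi)) = φ x := h.2.sub_int_mul_eq n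
  have e2 : Real.cos (x - s - n * (2 * Real.pi)) = Real.cos (x - s) :=
    Real.cos_sub_int_mul_two_pi _ _
  have h1 := hlip s (x - n * (2 * Real.pi))
  rw [e1, sub_right_comm] at h1
  have h2 := Real.cos_le_one_sub_mul_cos_sq hn
  rw [e2] at h2
  have h3 : (φ x - φ s) ^ 2 ≤ B ^ 2 * (x - s - n * (2 * Real.pi)) ^ 2 := by
    rw [← sq_abs (φ x - φ s), ← sq_abs (x - s - n * (2 * Real.pi)), ← mul_pow]
    exact pow_le_pow_left₀ (abs_nonneg _) h1 2
  refine h3.trans ?_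
  rw [mul_assoc]
  gcongr
  have hp := Real.pi_pos
  have h4 : 2 / Real.pi ^ 2 * (x - s - n * (2 * Real.pi)) ^ 2 ≤ 1 - Real.cos (x - s) := by linarith
  calc (x - s - n * (2 * Real.pi)) ^ 2
      = Real.pi ^ 2 / 2 * (2 / Real.pi ^ 2 * (x - s - n * (2 * Real.pi)) ^ 2) := by field_simp
    _ ≤ _ := by gcongr

/-- Variance is at most the second moment about any point; the point used is the value `φ s` at the
centre of the kernel. -/
theorem IsTest.kernel_variance {φ : ℝ → ℝ} (h : IsTest φ) {n : ℕ} (hn : n ≠ 0) (s : ℝ) :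
    (∫ x, φ x ^ 2 * kernel n (x - s) ∂cell) * kernelMass n
      ≤ (∫ x, φ x * kernel n (x - s) ∂cell) ^ 2
        + (‖one‖ * ‖h.deriv.deriv.toL2‖) ^ 2 * (Real.pi ^ 2 / 2) * (kernelMass n ^ 2 / (n + 1)) := by
  have hk := (isTest_kernel n).translate s
  set L := (‖one‖ * ‖h.deriv.deriv.toL2‖) ^ 2 * (Real.pi ^ 2 / 2)
  set c := φ s
  set I := kernelMass n
  have hI : 0 < I := kernelMass_pos n
  have i2 := ((h.pow 2).mul hk).integrable
  have i1 := (h.mul hk).integrable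
  have h1 : ∫ x, (φ x - c) ^ 2 * kernel n (x - s) ∂cell
      ≤ ∫ x, L * (kernel n (x - s) * (1 - Real.cos (x - s))) ∂cell := by
    refine integral_mono (((h.sub (isTest_const c)).pow 2).mul hk).integrable
      ((hk.mul ((isTest_const 1).sub (isTest_cos_one.translate s))).const_mul L).integrable
      fun x => ?_
    have := mul_le_mul_of_nonneg_right (h.sq_sub_le s x) (kernel_nonneg n (x - s))
    refine this.trans (le_of_eq ?_)
    ring
  have e1 : ∫ x, L * (kernel n (x - s) * (1 - Real.cos (x - s))) ∂cell = L * (I / (n + 1)) := by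
    rw [integral_const_mul, ← integral_kernel_mul_one_sub_cos hn]
    congr 1
    exact ((isTest_kernel n).mul ((isTest_const 1).sub isTest_cos_one)).integral_translate s
  have e2 : ∫ x, (φ x - c) ^ 2 * kernel n (x - s) ∂cell
      = (∫ x, φ x ^ 2 * kernel n (x - s) ∂cell) - 2 * c * (∫ x, φ x * kernel n (x - s) ∂cell)
        + c ^ 2 * I := by
    have e3 : ∀ x, (φ x - c) ^ 2 * kernel n (x - s) = φ x ^ 2 * kernel n (x - s)
        - 2 * c * (φ x * kernel n (x - s)) + c ^ 2 * kernel n (x - s) := fun x => by ring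
    simp_rw [e3]
    rw [integral_add (f := fun x => φ x ^ 2 * kernel n (x - s)
        - 2 * c * (φ x * kernel n (x - s))) (i2.sub (i1.const_mul _)) (hk.integrable.const_mul _),
      integral_sub i2 (i1.const_mul _), integral_const_mul, integral_const_mul,
      (isTest_kernel n).integral_translate s]
    rfl
  rw [e1, e2] at h1
  set A := ∫ x, φ x ^ 2 * kernel n (x - s) ∂cell
  set b := ∫ x, φ x * kernel n (x - s) ∂cell
  have h2 := mul_le_mul_of_nonneg_right h1 hI.le
  have h3 : L * (I / (n + 1)) * I = L * (I ^ 2 / (n + 1)) := by ring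
  nlinarith [sq_nonneg (b - c * I)]

theorem HDot2.kernel_variance (f : HDot2) {n : ℕ} (hn : n ≠ 0) (s : ℝ) :
    ⟪f.sq, ((isTest_kernel n).translate s).toL2⟫ * kernelMass n
      ≤ ⟪f.val, ((isTest_kernel n).translate s).toL2⟫ ^ 2
        + (‖one‖ * ‖f.d2‖) ^ 2 * (Real.pi ^ 2 / 2) * (kernelMass n ^ 2 / (n + 1)) := by
  obtain ⟨φ, h, h0, t0, t1, t2⟩ := f.exists_tendsto
  refine le_of_tendsto_of_tendsto (((tendsto_sq t0 t1).inner tendsto_const_nhds).mul_const _)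
    (((t0.inner tendsto_const_nhds).pow 2).add
      ((((t2.norm.const_mul ‖one‖).pow 2).mul_const _).mul_const _))
    (Eventually.of_forall fun m => ?_)
  have := (h m).kernel_variance hn s
  simp only [(h m).sq_toHDot2, inner_toL2_toL2]
  rw [show ((h m).toHDot2 (h0 m)).val = (h m).toL2 from rfl, inner_toL2_toL2]
  exact this

/-! ### The gauge -/

theorem deriv_translate (φ : ℝ → ℝ) (s x : ℝ) :
    deriv (fun x => φ (x - s)) x = deriv φ (x - s) := by
  rw [deriv_comp_sub_const]

theorem toL2_deriv_translate {φ : ℝ → ℝ} (h : IsTest φ) (s : ℝ) :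
    (h.translate s).deriv.toL2 = (h.deriv.translate s).toL2 :=
  toL2_congr (h.translate s).deriv (h.deriv.translate s) (deriv_translate φ s)

theorem norm_toL2_translate {φ : ℝ → ℝ} (h : IsTest φ) (s : ℝ) :
    ‖(h.translate s).toL2‖ = ‖h.toL2‖ := by
  rw [← sq_eq_sq₀ (norm_nonneg _) (norm_nonneg _), ← real_inner_self_eq_norm_sq,
    ← real_inner_self_eq_norm_sq, inner_toL2_toL2, inner_toL2_toL2]
  exact (h.mul h).integral_translate s

/-- A gauge function: where `f ∈ Ḣ²` is orthogonal to the tangent of the orbit of `φ` under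
translations, the quadratic form `∫ f² φ_s'` is coercive up to a small multiple of `‖f_xx‖²`. -/
theorem exists_gauge {lam ε : ℝ} (hlam : 0 < lam) (hε : 0 < ε) :
    ∃ φ : ℝ → ℝ, ∃ h : IsTest φ, ∫ x, φ x ∂cell = 0 ∧ ∀ (f : HDot2) (s : ℝ),
      ⟪f.val, (h.translate s).deriv.toL2⟫ = 0 →
        lam * ‖f.val‖ ^ 2 - ε * ‖f.d2‖ ^ 2 ≤ ⟪f.sq, (h.translate s).deriv.toL2⟫ := by
  have hpi := Real.pi_pos
  set K := lam * (2 * Real.pi) * (‖one‖ ^ 2 * (Real.pi ^ 2 / 2)) with hK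
  have hK0 : 0 ≤ K := by positivity
  obtain ⟨m, hm⟩ := exists_nat_ge (K / ε)
  set n := m + 1 with hn
  have hnK : K / (n + 1) ≤ ε := by
    rw [div_le_iff₀ (by positivity), ← div_le_iff₀' hε]
    push_cast [hn]
    linarith
  set I := kernelMass n with hIdef
  have hI : 0 < I := kernelMass_pos n
  have hk := isTest_kernel n
  have hχ := (isTest_const lam).sub (hk.const_mul (lam * (2 * Real.pi) / I))
  have hχ0 : ∫ x, (lam - lam * (2 * Real.pi) / I * kernel n x) ∂cell = 0 := by
    rw [integral_sub (integrable_const _) (hk.integrable.const_mul _), integral_const_mul,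
      integral_const, cell_univ, ← kernelMass, ← hIdef, smul_eq_mul]
    field_simp
    simp
  -- The factor `2π / I` normalises the kernel so that the prescribed derivative has zero mean and
  -- thus a periodic primitive.
  obtain ⟨φ, h, h0, hφ⟩ := hχ.exists_primitive hχ0
  refine ⟨φ, h, h0, fun f s hs => ?_⟩
  have e : (h.translate s).deriv.toL2
      = lam • one - (lam * (2 * Real.pi) / I) • (hk.translate s).toL2 := by
    rw [one, ← toL2_const_mul, ← toL2_const_mul, ← toL2_sub]
    exact toL2_congr (h.translate s).deriv (((isTest_const 1).const_mul lam).sub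
      ((hk.translate s).const_mul (lam * (2 * Real.pi) / I)))
      (fun x => by rw [deriv_translate, hφ, mul_one])
  rw [e, inner_sub_right, inner_smul_right, inner_smul_right] at hs ⊢
  -- The constant part of the tangent does not see the mean-zero `f`, so orthogonality says exactly
  -- that the kernel-weighted mean of `f` is zero.
  rw [inner_one_val, mul_zero, zero_sub, neg_eq_zero] at hs
  have hs' : ⟪f.val, (hk.translate s).toL2⟫ = 0 :=
    (mul_eq_zero.1 hs).resolve_left (by positivity)
  have hv := f.kernel_variance (n := n) (by omega) s
  rw [hs'] at hv
  have h1 : ⟪f.sq, one⟫ = ‖f.val‖ ^ 2 := by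
    rw [one, f.inner_sq_toL2, norm_sq_eq_integral]
    simp
  rw [h1]
  have h2 : lam * (2 * Real.pi) / I * ⟪f.sq, (hk.translate s).toL2⟫ ≤ ε * ‖f.d2‖ ^ 2 := by
    have h3 : ⟪f.sq, (hk.translate s).toL2⟫
        ≤ (‖one‖ * ‖f.d2‖) ^ 2 * (Real.pi ^ 2 / 2) * (I / (n + 1)) := by
      refine le_of_mul_le_mul_right (hv.trans (le_of_eq ?_)) hI
      rw [← hIdef]
      ring
    calc lam * (2 * Real.pi) / I * ⟪f.sq, (hk.translate s).toL2⟫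
        ≤ lam * (2 * Real.pi) / I
          * ((‖one‖ * ‖f.d2‖) ^ 2 * (Real.pi ^ 2 / 2) * (I / (n + 1))) := by gcongr
      _ = K / (n + 1) * ‖f.d2‖ ^ 2 := by rw [hK]; field_simp
      _ ≤ _ := by gcongr
  linarith

/-! ### The orbit under translations and its nearest points. -/

/-- The orbit of a test function under translations. -/
def orbit {φ : ℝ → ℝ} (h : IsTest φ) : Set L2 := range fun s => (h.translate s).toL2

theorem IsTest.lipschitz {φ : ℝ → ℝ} (h : IsTest φ) :
    ∃ B, 0 ≤ B ∧ ∀ a b, |φ b - φ a| ≤ B * |b - a| := by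
  obtain ⟨B, hB⟩ := h.deriv.exists_bound
  exact ⟨B, (abs_nonneg _).trans (hB 0), fun a b =>
    convex_univ.norm_image_sub_le_of_norm_deriv_le (fun x _ => h.differentiable x)
      (fun x _ => hB x) (mem_univ a) (mem_univ b)⟩

theorem continuous_translate {φ : ℝ → ℝ} (h : IsTest φ) :
    Continuous fun s => (h.translate s).toL2 := by
  obtain ⟨B, hB, hlip⟩ := h.lipschitz
  refine continuous_iff_continuousAt.2 fun s => ?_
  rw [ContinuousAt, tendsto_iff_norm_sub_tendsto_zero]
  have hb : ∀ r, ‖(h.translate r).toL2 - (h.translate s).toL2‖ ≤ B * |r - s| * ‖one‖ := by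
    intro r
    refine Lp.norm_le_mul_norm_of_ae_le_mul ?_
    filter_upwards [Lp.coeFn_sub (h.translate r).toL2 (h.translate s).toL2,
      (h.translate r).coeFn_toL2, (h.translate s).coeFn_toL2, (isTest_const 1).coeFn_toL2]
      with x h1 h2 h3 h4
    rw [h1, Pi.sub_apply, h2, h3, one, h4, norm_one, mul_one]
    refine (hlip _ _).trans (le_of_eq ?_)
    rw [sub_sub_sub_cancel_left, abs_sub_comm]
  refine squeeze_zero (fun _ => norm_nonneg _) hb ?_
  have : Continuous fun r : ℝ => B * |r - s| * ‖one‖ := by fun_prop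
  simpa using this.tendsto s

theorem isCompact_orbit {φ : ℝ → ℝ} (h : IsTest φ) : IsCompact (orbit h) := by
  refine Function.Periodic.compact_of_continuous (c := 2 * Real.pi) (fun s => ?_)
    Real.two_pi_pos.ne' (continuous_translate h)
  exact toL2_congr (h.translate _) (h.translate s) fun x => by
    rw [← sub_sub, h.2.sub_eq]

theorem hasDerivAt_inner_translate {φ : ℝ → ℝ} (h : IsTest φ) (f : L2) (s : ℝ) :
    HasDerivAt (fun s => ⟪f, (h.translate s).toL2⟫) (-⟪f, (h.translate s).deriv.toL2⟫) s := by
  obtain ⟨B, hB⟩ := h.deriv.exists_bound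
  have hm : AEStronglyMeasurable f cell := Lp.aestronglyMeasurable f
  have key := (hasDerivAt_integral_of_dominated_loc_of_deriv_le (μ := cell) (𝕜 := ℝ)
    (F := fun s x => f x * φ (x - s)) (F' := fun s x => f x * -deriv φ (x - s)) (x₀ := s)
    (s := univ) (bound := fun x => |f x| * B) univ_mem
    (Eventually.of_forall fun r => (integrable_mul_test f (h.translate r)).aestronglyMeasurable)
    (integrable_mul_test f (h.translate s))
    (hm.mul (h.deriv.translate s).continuous.neg.aestronglyMeasurable)
    (ae_of_all _ fun x r _ => by
      rw [norm_mul, norm_neg, Real.norm_eq_abs, Real.norm_eq_abs]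
      exact mul_le_mul_of_nonneg_left (hB _) (abs_nonneg _))
    (((Lp.memLp f).integrable (by norm_num)).abs.mul_const B)
    (ae_of_all _ fun x r _ => by
      have h1 := ((h.hasDerivAt (x - r)).comp r ((hasDerivAt_id r).const_sub x)).const_mul (f x)
      simpa using h1)).2
  rw [toL2_deriv_translate h, inner_toL2, ← integral_neg]
  simp_rw [fun r => inner_toL2 f (h.translate r), ← mul_neg]
  exact key

/-- Compactness of the orbit gives a nearest point. All translates have the same norm, so minimising
the distance maximises `⟪f, φ_s⟫` over `s`, and the derivative there vanishes. -/
theorem exists_nearest_translate {φ : ℝ → ℝ} (h : IsTest φ) (f : L2) :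
    ∃ s, Metric.infDist f (orbit h) = ‖f - (h.translate s).toL2‖ ∧
      ⟪f, (h.translate s).deriv.toL2⟫ = 0 := by
  obtain ⟨_, ⟨s, rfl⟩, hs⟩ := (isCompact_orbit h).exists_infDist_eq_dist ⟨_, 0, rfl⟩ f
  rw [dist_eq_norm] at hs
  refine ⟨s, hs, ?_⟩
  have hmax : IsLocalMax (fun s => ⟪f, (h.translate s).toL2⟫) s := by
    refine Eventually.of_forall fun r => ?_
    have h1 : ‖f - (h.translate s).toL2‖ ≤ ‖f - (h.translate r).toL2‖ := by
      rw [← hs, ← dist_eq_norm]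
      exact Metric.infDist_le_dist_of_mem ⟨r, rfl⟩
    have h2 := pow_le_pow_left₀ (norm_nonneg _) h1 2
    rw [norm_sub_sq_real, norm_sub_sq_real, norm_toL2_translate h, norm_toL2_translate h] at h2
    simp only
    linarith
  have := hmax.hasDerivAt_eq_zero (hasDerivAt_inner_translate h f s)
  linarith

/-! ### The bound in `L²` -/

/-- Of the viscosity `ν`, the gauge hypothesis costs `ν/2` and the cross term with `v.d2` costs
`ν/8`, which leaves `3ν/8`. Half of the coercivity `lam` survives as damping. -/
theorem energy_le {ν α lam : ℝ} (hν : 0 < ν) (u w v : HDot2)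
    (h : lam * ‖u.val‖ ^ 2 - ν * ‖u.d2‖ ^ 2 ≤ ⟪u.sq, v.d1⟫) :
    ⟪(-ν) • u.d2, u.d2 - v.d2⟫ + ⟪flux α u w, u.d1 - v.d1⟫
      ≤ -(3 / 8 * ν) * ‖u.d2‖ ^ 2 + (3 / 2 + |α| / 2) * ‖u.d1‖ ^ 2 + |α| * ‖w.d1‖ ^ 2
        - lam / 2 * ‖u.val‖ ^ 2 + 2 * ν * ‖v.d2‖ ^ 2 + (1 + |α|) / 2 * ‖v.d1‖ ^ 2 := by
  have e : ⟪(-ν) • u.d2, u.d2 - v.d2⟫ + ⟪flux α u w, u.d1 - v.d1⟫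
      = -ν * ‖u.d2‖ ^ 2 + ν * ⟪u.d2, v.d2⟫ + ‖u.d1‖ ^ 2 - ⟪u.d1, v.d1⟫
        - 1 / 2 * ⟪u.sq, v.d1⟫ + α * ⟪w.d1, u.d1⟫ - α * ⟪w.d1, v.d1⟫ := by
    simp only [flux, inner_add_left, inner_sub_right, real_inner_smul_left,
      real_inner_self_eq_norm_sq, u.inner_sq_d1]
    ring
  rw [e]
  have h1 := real_inner_le_norm u.d2 v.d2
  have h2 := neg_le_of_abs_le (abs_real_inner_le_norm u.d1 v.d1)
  have h3 : α * ⟪w.d1, u.d1⟫ ≤ |α| * (‖w.d1‖ * ‖u.d1‖) := by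
    refine (le_abs_self _).trans ?_
    rw [abs_mul]
    exact mul_le_mul_of_nonneg_left (abs_real_inner_le_norm _ _) (abs_nonneg _)
  have h4 : -(α * ⟪w.d1, v.d1⟫) ≤ |α| * (‖w.d1‖ * ‖v.d1‖) := by
    refine (neg_le_abs _).trans ?_
    rw [abs_mul]
    exact mul_le_mul_of_nonneg_left (abs_real_inner_le_norm _ _) (abs_nonneg _)
  have h5 := mul_le_mul_of_nonneg_left h1 hν.le
  have h6 : ν * (‖u.d2‖ * ‖v.d2‖) ≤ ν * (‖u.d2‖ ^ 2 / 8 + 2 * ‖v.d2‖ ^ 2) :=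
    mul_le_mul_of_nonneg_left (by nlinarith [sq_nonneg (‖u.d2‖ - 4 * ‖v.d2‖)]) hν.le
  have h7 : ‖u.d1‖ * ‖v.d1‖ ≤ ‖u.d1‖ ^ 2 / 2 + ‖v.d1‖ ^ 2 / 2 := by
    nlinarith [sq_nonneg (‖u.d1‖ - ‖v.d1‖)]
  have h8 : |α| * (‖w.d1‖ * ‖u.d1‖) ≤ |α| * (‖w.d1‖ ^ 2 / 2 + ‖u.d1‖ ^ 2 / 2) :=
    mul_le_mul_of_nonneg_left (by nlinarith [sq_nonneg (‖w.d1‖ - ‖u.d1‖)]) (abs_nonneg _)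
  have h9 : |α| * (‖w.d1‖ * ‖v.d1‖) ≤ |α| * (‖w.d1‖ ^ 2 / 2 + ‖v.d1‖ ^ 2 / 2) :=
    mul_le_mul_of_nonneg_left (by nlinarith [sq_nonneg (‖w.d1‖ - ‖v.d1‖)]) (abs_nonneg _)
  linarith

theorem HDot2.interpolation (u : HDot2) {ν A : ℝ} (hν : 0 < ν) (hA : 0 ≤ A) :
    A * ‖u.d1‖ ^ 2 ≤ ν / 4 * ‖u.d2‖ ^ 2 + A ^ 2 / ν * ‖u.val‖ ^ 2 := by
  refine (mul_le_mul_of_nonneg_left u.norm_d1_sq_le hA).trans ?_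
  have : ν / 4 * ‖u.d2‖ ^ 2 + A ^ 2 / ν * ‖u.val‖ ^ 2 - A * (‖u.val‖ * ‖u.d2‖)
      = 1 / (4 * ν) * (ν * ‖u.d2‖ - 2 * A * ‖u.val‖) ^ 2 := by
    field_simp
    ring
  have h2 : 0 ≤ 1 / (4 * ν) * (ν * ‖u.d2‖ - 2 * A * ‖u.val‖) ^ 2 := by positivity
  linarith

/-- The translate by `s` of a mean-zero test function, as an element of `Ḣ²`. -/
def shift {φ : ℝ → ℝ} (h : IsTest φ) (h0 : ∫ x, φ x ∂cell = 0) (s : ℝ) : HDot2 :=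
  (h.translate s).toHDot2 ((h.integral_translate s).trans h0)

theorem norm_shift_val {φ : ℝ → ℝ} (h : IsTest φ) (h0 : ∫ x, φ x ∂cell = 0) (s : ℝ) :
    ‖(shift h h0 s).val‖ = ‖h.toL2‖ := norm_toL2_translate h s

theorem norm_shift_d1 {φ : ℝ → ℝ} (h : IsTest φ) (h0 : ∫ x, φ x ∂cell = 0) (s : ℝ) :
    ‖(shift h h0 s).d1‖ = ‖h.deriv.toL2‖ := by
  rw [← norm_toL2_translate h.deriv s, ← toL2_deriv_translate h]
  rfl

theorem norm_shift_d2 {φ : ℝ → ℝ} (h : IsTest φ) (h0 : ∫ x, φ x ∂cell = 0) (s : ℝ) :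
    ‖(shift h h0 s).d2‖ = ‖h.deriv.deriv.toL2‖ := by
  rw [← norm_toL2_translate h.deriv.deriv s, ← toL2_deriv_translate h.deriv]
  congr 1
  refine toL2_congr (h.translate s).deriv.deriv (h.deriv.translate s).deriv fun x => ?_
  rw [funext (deriv_translate φ s)]

theorem norm_sub_sq_le (x y : L2) : ‖x - y‖ ^ 2 ≤ 2 * ‖x‖ ^ 2 + 2 * ‖y‖ ^ 2 := by
  have := pow_le_pow_left₀ (norm_nonneg _) (norm_sub_le x y) 2
  nlinarith [sq_nonneg (‖x‖ - ‖y‖)]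

theorem exists_dissipative_orbit (ν α₁ α₂ : ℝ) (hν : 0 < ν) :
    ∃ φ : ℝ → ℝ, ∃ h : IsTest φ, ∃ K : ℝ, 0 ≤ K ∧ ∀ (T : ℝ) (u₁ u₂ : ℝ → HDot2),
      IsTrajectory ν α₁ T u₁ u₂ → IsTrajectory ν α₂ T u₂ u₁ → ∀ t ∈ Icc 0 T,
        Metric.infDist (u₁ t).val (orbit h) ^ 2 + Metric.infDist (u₂ t).val (orbit h) ^ 2
          ≤ (Metric.infDist (u₁ 0).val (orbit h) ^ 2 + Metric.infDist (u₂ 0).val (orbit h) ^ 2)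
            * Real.exp (-ν * t) + K := by
  set A := 2 + |α₁| + |α₂| with hA
  have ha1 := abs_nonneg α₁
  have ha2 := abs_nonneg α₂
  have hA0 : 0 ≤ A := by positivity
  -- Half of `lam` must absorb the zeroth-order term `A² / ν` from interpolating `A ‖u_x‖²` and
  -- leave `ν ‖u‖²`, which becomes decay at rate `ν` for the squared distance.
  obtain ⟨φ, h, h0, hφ⟩ := exists_gauge (lam := 2 * (A ^ 2 / ν) + 2 * ν) (ε := ν)
    (by positivity) hν
  set d := ‖h.toL2‖
  set c := ‖h.deriv.toL2‖
  set b := ‖h.deriv.deriv.toL2‖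
  set K := 4 * ν * d ^ 2 + 8 * ν * b ^ 2 + 2 * A * c ^ 2 with hK
  have hK0 : 0 ≤ K := by positivity
  refine ⟨φ, h, K / ν, by positivity, fun T u₁ u₂ H₁ H₂ t ht => ?_⟩
  set F : ℝ → ℝ := fun t =>
    Metric.infDist (u₁ t).val (orbit h) ^ 2 + Metric.infDist (u₂ t).val (orbit h) ^ 2 with hF
  have hcont : Continuous F :=
    (((Metric.continuous_infDist_pt _).comp H₁.left.val).pow 2).add
      (((Metric.continuous_infDist_pt _).comp H₂.left.val).pow 2)
  have key := le_gronwallBound_of_liminf_deriv_right_le (f := F) (f' := fun t => -ν * F t + K)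
    (δ := F 0) (K := -ν) (ε := K) (a := 0) (b := T) hcont.continuousOn ?_ le_rfl
    (fun _ _ => le_rfl) t ht
  · rw [gronwallBound_of_K_ne_0 (neg_ne_zero.2 hν.ne'), sub_zero] at key
    have h1 : K / -ν * (Real.exp (-ν * t) - 1) ≤ K / ν := by
      have : K / -ν * (Real.exp (-ν * t) - 1) = K / ν - K / ν * Real.exp (-ν * t) := by
        rw [div_neg]; ring
      rw [this]
      have : 0 ≤ K / ν * Real.exp (-ν * t) := by positivity
      linarith
    exact key.trans (by linarith)
  · intro x hx r hr
    have hx' : x ∈ Icc 0 T := Ico_subset_Icc_self hx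
    obtain ⟨s₁, hs₁, ho₁⟩ := exists_nearest_translate h (u₁ x).val
    obtain ⟨s₂, hs₂, ho₂⟩ := exists_nearest_translate h (u₂ x).val
    have hd := ((H₁.hasDerivWithinAt_dist_sq (shift h h0 s₁) hx').add
      (H₂.hasDerivWithinAt_dist_sq (shift h h0 s₂) hx')).mono_of_mem_nhdsWithin
      (Icc_mem_nhdsGE_of_mem hx)
    have E₁ := energy_le (α := α₁) hν (u₁ x) (u₂ x) (shift h h0 s₁) (hφ _ _ ho₁)
    have E₂ := energy_le (α := α₂) hν (u₂ x) (u₁ x) (shift h h0 s₂) (hφ _ _ ho₂)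
    have hFx : F x = ‖(u₁ x).val - (shift h h0 s₁).val‖ ^ 2
        + ‖(u₂ x).val - (shift h h0 s₂).val‖ ^ 2 := by
      simp only [hF]
      rw [hs₁, hs₂]
      rfl
    have hlt : 2 * (⟪(-ν) • (u₁ x).d2, (u₁ x).d2 - (shift h h0 s₁).d2⟫
          + ⟪flux α₁ (u₁ x) (u₂ x), (u₁ x).d1 - (shift h h0 s₁).d1⟫)
        + 2 * (⟪(-ν) • (u₂ x).d2, (u₂ x).d2 - (shift h h0 s₂).d2⟫
          + ⟪flux α₂ (u₂ x) (u₁ x), (u₂ x).d1 - (shift h h0 s₂).d1⟫) < r := by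
      refine lt_of_le_of_lt ?_ hr
      have D₁ := norm_sub_sq_le (u₁ x).val (shift h h0 s₁).val
      have D₂ := norm_sub_sq_le (u₂ x).val (shift h h0 s₂).val
      have I₁ := (u₁ x).interpolation hν hA0
      have I₂ := (u₂ x).interpolation hν hA0
      rw [norm_shift_val] at D₁ D₂
      rw [norm_shift_d1, norm_shift_d2] at E₁ E₂
      have N₁ := mul_le_mul_of_nonneg_left D₁ hν.le
      have N₂ := mul_le_mul_of_nonneg_left D₂ hν.le
      have P₁ : (3 / 2 + |α₁| / 2 + |α₂|) * ‖(u₁ x).d1‖ ^ 2 ≤ A * ‖(u₁ x).d1‖ ^ 2 := by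
        gcongr
        linarith
      have P₂ : (3 / 2 + |α₂| / 2 + |α₁|) * ‖(u₂ x).d1‖ ^ 2 ≤ A * ‖(u₂ x).d1‖ ^ 2 := by
        gcongr
        linarith
      have Q : ((1 + |α₁|) + (1 + |α₂|)) * c ^ 2 ≤ 2 * A * c ^ 2 := by
        gcongr
        linarith
      have R₁ : 0 ≤ ν * ‖(u₁ x).d2‖ ^ 2 := by positivity
      have R₂ : 0 ≤ ν * ‖(u₂ x).d2‖ ^ 2 := by positivity
      simp only [hFx]
      linarith
    -- With `s₁, s₂` frozen at time `x`, the squared distances to these translates dominate `F` and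
    -- agree with it at `x`, so they bound its right slopes.
    refine (hd.liminf_right_slope_le hlt).mp ?_
    filter_upwards [self_mem_nhdsWithin] with z hz hslope
    refine lt_of_le_of_lt ?_ hslope
    rw [slope_def_module, smul_eq_mul]
    refine mul_le_mul_of_nonneg_left ?_ (inv_nonneg.2 (sub_nonneg.2 (le_of_lt hz)))
    rw [hFx]
    have hle : ∀ (f : L2) (s : ℝ), Metric.infDist f (orbit h) ^ 2
        ≤ ‖f - (shift h h0 s).val‖ ^ 2 := fun f s => by
      refine pow_le_pow_left₀ Metric.infDist_nonneg ?_ 2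
      rw [← dist_eq_norm]
      exact Metric.infDist_le_dist_of_mem ⟨s, rfl⟩
    have l₁ := hle (u₁ z).val s₁
    have l₂ := hle (u₂ z).val s₂
    simp only [hF, Pi.add_apply]
    linarith

/-- Every translate has norm `d`, so distance to the orbit and norm differ by at most `d`. Taking
square roots halves the rate. -/
theorem exists_L2_bound (ν α₁ α₂ : ℝ) (hν : 0 < ν) :
    ∃ c : ℝ, 0 < c ∧ ∀ (T : ℝ) (u₁ u₂ : ℝ → HDot2),
      IsTrajectory ν α₁ T u₁ u₂ → IsTrajectory ν α₂ T u₂ u₁ → ∀ t ∈ Icc 0 T,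
        ‖(u₁ t).val‖ + ‖(u₂ t).val‖
          ≤ c + c * (‖(u₁ 0).val‖ + ‖(u₂ 0).val‖) * Real.exp (-(ν / 2) * t) := by
  obtain ⟨φ, h, K, hK, hφ⟩ := exists_dissipative_orbit ν α₁ α₂ hν
  set d := ‖h.toL2‖
  have hd : 0 ≤ d := norm_nonneg _
  have hup : ∀ f : L2, Metric.infDist f (orbit h) ≤ ‖f‖ + d := fun f => by
    have hm : (h.translate 0).toL2 ∈ orbit h := ⟨0, rfl⟩
    refine (Metric.infDist_le_dist_of_mem hm).trans ?_
    rw [dist_eq_norm]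
    exact (norm_sub_le _ _).trans_eq (by rw [norm_toL2_translate h 0])
  have hlow : ∀ f : L2, ‖f‖ ≤ Metric.infDist f (orbit h) + d := fun f => by
    obtain ⟨s, hs, -⟩ := exists_nearest_translate h f
    rw [hs]
    linarith [norm_sub_norm_le f (h.translate s).toL2, norm_toL2_translate h s]
  refine ⟨2 + 6 * d + 2 * Real.sqrt K, by positivity, fun T u₁ u₂ H₁ H₂ t ht => ?_⟩
  have hF := hφ T u₁ u₂ H₁ H₂ t ht
  set a := Metric.infDist (u₁ t).val (orbit h)
  set b := Metric.infDist (u₂ t).val (orbit h)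
  set N := ‖(u₁ 0).val‖ + ‖(u₂ 0).val‖
  set E := Real.exp (-(ν / 2) * t)
  have hE : Real.exp (-ν * t) = E ^ 2 := by
    rw [← Real.exp_nat_mul]
    congr 1
    push_cast
    ring
  have hE0 : 0 < E := Real.exp_pos _
  have hE1 : E ≤ 1 := Real.exp_le_one_iff.2 (by nlinarith [ht.1])
  have hN : 0 ≤ N := by positivity
  have h1 : Metric.infDist (u₁ 0).val (orbit h) ^ 2 + Metric.infDist (u₂ 0).val (orbit h) ^ 2
      ≤ (N + 2 * d) ^ 2 := by
    have e1 := pow_le_pow_left₀ Metric.infDist_nonneg (hup (u₁ 0).val) 2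
    have e2 := pow_le_pow_left₀ Metric.infDist_nonneg (hup (u₂ 0).val) 2
    have e3 : 0 ≤ (‖(u₁ 0).val‖ + d) * (‖(u₂ 0).val‖ + d) := by positivity
    have e4 : (N + 2 * d) ^ 2 = (‖(u₁ 0).val‖ + d) ^ 2 + (‖(u₂ 0).val‖ + d) ^ 2
        + 2 * ((‖(u₁ 0).val‖ + d) * (‖(u₂ 0).val‖ + d)) := by
      simp only [N]
      ring
    linarith
  have h2 : a ^ 2 + b ^ 2 ≤ ((N + 2 * d) * E + Real.sqrt K) ^ 2 := by
    rw [hE] at hF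
    have e1 := mul_le_mul_of_nonneg_right h1 (sq_nonneg E)
    have e2 : 0 ≤ (N + 2 * d) * E * Real.sqrt K := by positivity
    have e3 := Real.sq_sqrt hK
    nlinarith
  have h3 : a ≤ (N + 2 * d) * E + Real.sqrt K :=
    le_of_sq_le_sq (by linarith [sq_nonneg b]) (by positivity)
  have h4 : b ≤ (N + 2 * d) * E + Real.sqrt K :=
    le_of_sq_le_sq (by linarith [sq_nonneg a]) (by positivity)
  have h5 := hlow (u₁ t).val
  have h6 := hlow (u₂ t).val
  have h7 : d * E ≤ d := mul_le_of_le_one_right hd hE1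
  have h8 : 0 ≤ (6 * d + 2 * Real.sqrt K) * N * E := by positivity
  calc ‖(u₁ t).val‖ + ‖(u₂ t).val‖ ≤ 2 * ((N + 2 * d) * E + Real.sqrt K) + 2 * d := by linarith
    _ ≤ 2 + 6 * d + 2 * Real.sqrt K + (2 + 6 * d + 2 * Real.sqrt K) * N * E := by linarith

/-! ### Decay of the Fourier coefficients -/

/-- Multiply by the integrating factor `exp (a t)` and compare with the explicit integral of the
forcing bound. Integrating `exp ((a - D) t)` produces `1 / (a - D)`; the gap `2 D ≤ a` turns this
into `2 / a`, so the full gain from the damping is kept. -/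
theorem norm_le_of_duhamel {a D T H₀ H₁ : ℝ} {z h : ℝ → ℂ} (hD : 0 < D) (ha : 2 * D ≤ a)
    (hH₀ : 0 ≤ H₀) (hH₁ : 0 ≤ H₁)
    (hz : ∀ t ∈ Icc 0 T, HasDerivWithinAt z (-(a : ℂ) * z t + h t) (Icc 0 T) t)
    (hh : ∀ t ∈ Icc 0 T, ‖h t‖ ≤ H₀ + H₁ * Real.exp (-D * t)) {t : ℝ} (ht : t ∈ Icc 0 T) :
    ‖z t‖ ≤ ‖z 0‖ * Real.exp (-D * t) + 2 / a * (H₀ + H₁ * Real.exp (-D * t)) := by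
  have ha0 : 0 < a := by linarith
  have had : 0 < a - D := by linarith
  have hexp : ∀ s : ℝ, HasDerivAt (fun s : ℝ => Real.exp (a * s)) (a * Real.exp (a * s)) s := by
    intro s
    have := ((hasDerivAt_id s).const_mul a).exp
    simpa [mul_comm] using this
  have hexp' : ∀ s : ℝ, HasDerivAt (fun s : ℝ => Real.exp ((a - D) * s))
      ((a - D) * Real.exp ((a - D) * s)) s := by
    intro s
    have := ((hasDerivAt_id s).const_mul (a - D)).exp
    simpa [mul_comm] using this
  have hf : ∀ s ∈ Icc 0 T, HasDerivWithinAt (fun s => Real.exp (a * s) • z s)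
      (Real.exp (a * s) • h s) (Icc 0 T) s := by
    intro s hs
    refine ((hexp s).hasDerivWithinAt.smul (hz s hs)).congr_deriv ?_
    simp only [Complex.real_smul]
    push_cast
    ring
  have key := image_norm_le_of_norm_deriv_right_le_deriv_boundary
    (f := fun s => Real.exp (a * s) • z s) (f' := fun s => Real.exp (a * s) • h s) (a := 0) (b := T)
    (fun s hs => (hf s hs).continuousWithinAt)
    (fun s hs => (hf s (Ico_subset_Icc_self hs)).mono_of_mem_nhdsWithin (Icc_mem_nhdsGE_of_mem hs))
    (B := fun s => ‖z 0‖ + H₀ / a * Real.exp (a * s) + H₁ / (a - D) * Real.exp ((a - D) * s))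
    (B' := fun s => H₀ / a * (a * Real.exp (a * s))
      + H₁ / (a - D) * ((a - D) * Real.exp ((a - D) * s)))
    (by
      simp only [mul_zero, Real.exp_zero, one_smul, mul_one]
      have : 0 ≤ H₀ / a := by positivity
      have : 0 ≤ H₁ / (a - D) := by positivity
      linarith)
    (fun s => (((hexp s).const_mul _).const_add _).add ((hexp' s).const_mul _))
    (fun s hs => by
      rw [norm_smul, Real.norm_eq_abs, Real.abs_exp]
      refine (mul_le_mul_of_nonneg_left (hh s (Ico_subset_Icc_self hs)) (Real.exp_pos _).le).trans
        (le_of_eq ?_)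
      have : Real.exp ((a - D) * s) = Real.exp (a * s) * Real.exp (-D * s) := by
        rw [← Real.exp_add]
        congr 1
        ring
      rw [this]
      field_simp) ht
  simp only [norm_smul, Real.norm_eq_abs, Real.abs_exp] at key
  have hE : Real.exp (a * t) * Real.exp (-D * t) = Real.exp ((a - D) * t) := by
    rw [← Real.exp_add]
    congr 1
    ring
  have hone : 1 ≤ Real.exp ((a - D) * t) := Real.one_le_exp (mul_nonneg had.le ht.1)
  have h1 : H₁ / (a - D) ≤ 2 / a * H₁ := by
    rw [div_mul_eq_mul_div, div_le_div_iff₀ had ha0]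
    nlinarith
  have h2 : H₀ / a ≤ 2 / a * H₀ := by
    rw [div_mul_eq_mul_div]
    gcongr
    linarith
  refine le_of_mul_le_mul_left (key.trans ?_) (Real.exp_pos (a * t))
  calc ‖z 0‖ + H₀ / a * Real.exp (a * t) + H₁ / (a - D) * Real.exp ((a - D) * t)
      ≤ ‖z 0‖ * Real.exp ((a - D) * t) + 2 / a * H₀ * Real.exp (a * t)
        + 2 / a * H₁ * Real.exp ((a - D) * t) := by
        gcongr
        exact le_mul_of_one_le_right (norm_nonneg _) hone
    _ = _ := by
      rw [← hE]
      ring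

/-- The Fourier coefficient as a continuous linear map. -/
def coeffL (k : ℤ) : L2 →L[ℝ] ℂ :=
  Complex.ofRealCLM.comp (innerSL ℝ (isTest_cos k).toL2)
    - Complex.I • Complex.ofRealCLM.comp (innerSL ℝ (isTest_sin k).toL2)

theorem coeffL_apply (k : ℤ) (f : L2) : coeffL k f = coeff k f := by
  apply Complex.ext <;> simp [coeffL, coeff, real_inner_comm]

theorem norm_coeff_le (k : ℤ) (f : L2) : ‖coeff k f‖ ≤ ‖one‖ * ‖f‖ := by
  refine le_of_sq_le_sq ?_ (by positivity)
  rw [mul_pow, norm_one_sq]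
  exact le_hasSum (hasSum_coeff_sq f) k fun _ _ => sq_nonneg _

/-- Only the `L¹` norm of `f²` enters, so the nonlinear forcing is controlled by the `L²` norm of
the solution alone. -/
theorem norm_coeff_sq_le (k : ℤ) (f : HDot2) : ‖coeff k f.sq‖ ≤ 2 * ‖f.val‖ ^ 2 := by
  refine (Complex.norm_le_abs_re_add_abs_im _).trans ?_
  have h1 := f.sq_integral_le (isTest_cos k) (fun x => Real.abs_cos_le_one _)
  have h2 := f.sq_integral_le (isTest_sin k) (fun x => Real.abs_sin_le_one _)
  simp only [coeff, abs_neg]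
  linarith

theorem toL2_deriv_deriv_cos (k : ℤ) :
    (isTest_cos k).deriv.deriv.toL2 = (-(k : ℝ) ^ 2) • (isTest_cos k).toL2 := by
  rw [← toL2_const_mul]
  refine toL2_congr (isTest_cos k).deriv.deriv ((isTest_cos k).const_mul _) fun x => ?_
  rw [funext (deriv_cos_int k), deriv_const_mul_field, deriv_sin_int]
  ring

theorem toL2_deriv_deriv_sin (k : ℤ) :
    (isTest_sin k).deriv.deriv.toL2 = (-(k : ℝ) ^ 2) • (isTest_sin k).toL2 := by
  rw [← toL2_const_mul]
  refine toL2_congr (isTest_sin k).deriv.deriv ((isTest_sin k).const_mul _) fun x => ?_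
  rw [funext (deriv_sin_int k), deriv_const_mul_field, deriv_cos_int]
  ring

/-- The terms of lower order in the equation for the `k`-th Fourier coefficient. -/
def forcing (α : ℝ) (k : ℤ) (u w : HDot2) : ℂ :=
  (k : ℂ) ^ 2 * coeff k u.val + α * (k : ℂ) ^ 2 * coeff k w.val
    - 1 / 2 * (k * Complex.I) * coeff k u.sq

theorem IsTrajectory.hasDerivWithinAt_coeff {ν α T : ℝ} {u w : ℝ → HDot2}
    (H : IsTrajectory ν α T u w) (k : ℤ) {t : ℝ} (ht : t ∈ Icc 0 T) :
    HasDerivWithinAt (fun t => coeff k (u t).val)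
      (-((ν * |(k : ℝ)| ^ 4 : ℝ) : ℂ) * coeff k (u t).val + forcing α k (u t) (w t))
      (Icc 0 T) t := by
  have hP := ((H.left.d2.fun_const_smul (-ν)).integral_hasStrictDerivAt 0 t).hasDerivAt
  have hQ := ((H.left.flux H.right α).integral_hasStrictDerivAt 0 t).hasDerivAt
  have hP' := ((coeffL k).hasFDerivAt.comp_hasDerivAt t hP).const_mul (-(k : ℂ) ^ 2)
  have hQ' := ((coeffL k).hasFDerivAt.comp_hasDerivAt t hQ).const_mul (-(k * Complex.I))
  have hz := ((hP'.add hQ').const_add (coeff k (u 0).val)).hasDerivWithinAt (s := Icc 0 T)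
  have heq : ∀ s ∈ Icc 0 T, coeff k (u s).val = coeff k (u 0).val
      + (-(k : ℂ) ^ 2 * coeffL k (∫ r in (0 : ℝ)..s, (-ν) • (u r).d2)
        + -(k * Complex.I) * coeffL k (∫ r in (0 : ℝ)..s, flux α (u r) (w r))) := by
    intro s hs
    have e1 := H.equation _ (isTest_cos k) s hs
    have e2 := H.equation _ (isTest_sin k) s hs
    rw [toL2_deriv_deriv_cos, toL2_deriv_cos, inner_smul_right, inner_smul_right,
      inner_sub_left] at e1
    rw [toL2_deriv_deriv_sin, toL2_deriv_sin, inner_smul_right, inner_smul_right,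
      inner_sub_left] at e2
    rw [coeffL_apply, coeffL_apply]
    apply Complex.ext
    · simp [coeff, pow_two] at e1 ⊢
      linarith
    · simp [coeff, pow_two] at e2 ⊢
      linarith
  refine (hz.congr (fun s hs => heq s hs) (heq t ht)).congr_deriv ?_
  have hf : coeff k (flux α (u t) (w t))
      = coeff k (u t).d1 + (1 / 2 : ℝ) * coeff k (u t).sq + α * coeff k (w t).d1 := by
    rw [← coeffL_apply, flux, map_add, map_add, map_smul, map_smul, coeffL_apply, coeffL_apply,
      coeffL_apply, Complex.real_smul, Complex.real_smul]
  have hs : coeff k ((-ν) • (u t).d2) = -ν * coeff k (u t).d2 := by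
    rw [← coeffL_apply, map_smul, coeffL_apply, Complex.real_smul]
    push_cast
    rfl
  have hk : |(k : ℝ)| ^ 4 = (k : ℝ) ^ 4 := Even.pow_abs (by decide) _
  rw [coeffL_apply, coeffL_apply, hf, hs, (u t).hasWeakDeriv_d1.coeff, (u t).hasWeakDeriv_val.coeff,
    (w t).hasWeakDeriv_val.coeff, forcing, hk]
  push_cast
  linear_combination (ν * (k : ℂ) ^ 4 * coeff k (u t).val - (k : ℂ) ^ 2 * coeff k (u t).val
    - α * (k : ℂ) ^ 2 * coeff k (w t).val) * Complex.I_sq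

theorem norm_forcing_le {α A : ℝ} (hA : 1 + |α| ≤ A) (k : ℤ) (u w : HDot2) :
    ‖forcing α k u w‖ ≤ A * |(k : ℝ)| ^ 2 * (‖coeff k u.val‖ + ‖coeff k w.val‖)
      + |(k : ℝ)| * ‖u.val‖ ^ 2 := by
  have hα := abs_nonneg α
  have h1 : ‖(k : ℂ) ^ 2 * coeff k u.val‖ ≤ A * |(k : ℝ)| ^ 2 * ‖coeff k u.val‖ := by
    rw [norm_mul, norm_pow, Complex.norm_intCast]
    gcongr
    exact le_mul_of_one_le_left (by positivity) (by linarith)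
  have h2 : ‖α * (k : ℂ) ^ 2 * coeff k w.val‖ ≤ A * |(k : ℝ)| ^ 2 * ‖coeff k w.val‖ := by
    rw [norm_mul, norm_mul, norm_pow, Complex.norm_intCast, Complex.norm_real, Real.norm_eq_abs]
    gcongr
    linarith
  have h3 : ‖1 / 2 * (k * Complex.I) * coeff k u.sq‖ ≤ |(k : ℝ)| * ‖u.val‖ ^ 2 := by
    have := mul_le_mul_of_nonneg_left (norm_coeff_sq_le k u) (abs_nonneg (k : ℝ))
    rw [norm_mul, norm_mul, norm_mul, Complex.norm_intCast, Complex.norm_I]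
    norm_num
    linarith
  rw [forcing]
  refine (norm_sub_le _ _).trans ?_
  have := norm_add_le ((k : ℂ) ^ 2 * coeff k u.val) (α * (k : ℂ) ^ 2 * coeff k w.val)
  linarith

/-- The bound for the lower order terms produced by an `L²` bound `L`. -/
def forcingBound (A L : ℝ) : ℝ := A * ‖one‖ * L + 2 * L ^ 2

/-- The bound for the smooth part of the solution produced by an `L²` bound `L`. -/
def smoothBound (ν A L : ℝ) : ℝ := 4 * A / ν * forcingBound A L + 2 * L ^ 2

section pointwise

variable {ν T L₀ L₁ A : ℝ}

theorem sq_le_of_le_add {S E : ℝ} (hS : 0 ≤ S) (hE : 0 ≤ E) (hE1 : E ≤ 1)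
    (h : S ≤ L₀ + L₁ * E) : S ^ 2 ≤ 2 * L₀ ^ 2 + 2 * L₁ ^ 2 * E := by
  have h1 := pow_le_pow_left₀ hS h 2
  have h2 : E ^ 2 ≤ E := by nlinarith
  have h3 : L₁ ^ 2 * E ^ 2 ≤ L₁ ^ 2 * E := mul_le_mul_of_nonneg_left h2 (sq_nonneg _)
  nlinarith [sq_nonneg (L₀ - L₁ * E)]

/-- With only the `L²` bound, all forcing is of order `k²`; dividing by the damping `ν k⁴` gives
`k⁻²`. -/
theorem coeff_bound_one {α : ℝ} (hν : 0 < ν) (hA : 1 + |α| ≤ A) (hL₀ : 0 ≤ L₀) (hL₁ : 0 ≤ L₁)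
    {u w : ℝ → HDot2} (H : IsTrajectory ν α T u w)
    (hL : ∀ t ∈ Icc 0 T, ‖(u t).val‖ + ‖(w t).val‖ ≤ L₀ + L₁ * Real.exp (-(ν / 2) * t))
    {k : ℤ} (hk : k ≠ 0) {t : ℝ} (ht : t ∈ Icc 0 T) :
    ‖coeff k (u t).val‖ ≤ ‖coeff k (u 0).val‖ * Real.exp (-(ν / 2) * t)
      + 2 / ν * (forcingBound A L₀ + forcingBound A L₁ * Real.exp (-(ν / 2) * t))
        / |(k : ℝ)| ^ 2 := by
  have hA0 : 0 ≤ A := by linarith [abs_nonneg α]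
  set m := |(k : ℝ)| with hm
  have hm1 : 1 ≤ m := by rw [hm]; exact_mod_cast Int.one_le_abs hk
  have hm0 : 0 < m := by linarith
  have hm4 : 1 ≤ m ^ 4 := one_le_pow₀ hm1
  have hF₀ : 0 ≤ forcingBound A L₀ := by unfold forcingBound; positivity
  have hF₁ : 0 ≤ forcingBound A L₁ := by unfold forcingBound; positivity
  have key := norm_le_of_duhamel (a := ν * m ^ 4) (D := ν / 2) (T := T)
    (H₀ := m ^ 2 * forcingBound A L₀) (H₁ := m ^ 2 * forcingBound A L₁) (by positivity)
    (by nlinarith) (by positivity) (by positivity)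
    (fun s hs => H.hasDerivWithinAt_coeff k hs) (fun s hs => ?_) ht
  · refine key.trans (le_of_eq ?_)
    field_simp
  · set E := Real.exp (-(ν / 2) * s)
    have hE : 0 < E := Real.exp_pos _
    have hE1 : E ≤ 1 := Real.exp_le_one_iff.2 (by nlinarith [hs.1])
    have hS := hL s hs
    have h1 := norm_coeff_le k (u s).val
    have h2 := norm_coeff_le k (w s).val
    have h3 : ‖coeff k (u s).val‖ + ‖coeff k (w s).val‖ ≤ ‖one‖ * (L₀ + L₁ * E) := by
      refine le_trans ?_ (mul_le_mul_of_nonneg_left hS (norm_nonneg _))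
      linarith
    have h4 := sq_le_of_le_add (norm_nonneg (u s).val) hE.le hE1
      (show ‖(u s).val‖ ≤ L₀ + L₁ * E by linarith [norm_nonneg (w s).val])
    calc ‖forcing α k (u s) (w s)‖
        ≤ A * m ^ 2 * (‖coeff k (u s).val‖ + ‖coeff k (w s).val‖) + m * ‖(u s).val‖ ^ 2 :=
          norm_forcing_le hA k _ _
      _ ≤ A * m ^ 2 * (‖one‖ * (L₀ + L₁ * E)) + m ^ 2 * (2 * L₀ ^ 2 + 2 * L₁ ^ 2 * E) := by
          gcongr
          exact le_self_pow₀ hm1 two_ne_zero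
      _ = _ := by
          unfold forcingBound
          ring

/-- Feeding `coeff_bound_one` for both components into the linear forcing makes it bounded in `k`,
apart from the decaying initial part. The quadratic term, of order `|k|`, now dominates and yields
`|k|⁻³`. The initial coefficients stay explicit so that each Sobolev norm of the data can be
reassembled later. -/
theorem coeff_bound_two {α β : ℝ} (hν : 0 < ν) (hA : 1 + |α| ≤ A) (hA' : 1 + |β| ≤ A)
    (hL₀ : 0 ≤ L₀) (hL₁ : 0 ≤ L₁) {u w : ℝ → HDot2} (H : IsTrajectory ν α T u w)
    (H' : IsTrajectory ν β T w u)
    (hL : ∀ t ∈ Icc 0 T, ‖(u t).val‖ + ‖(w t).val‖ ≤ L₀ + L₁ * Real.exp (-(ν / 2) * t))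
    {k : ℤ} (hk : k ≠ 0) {t : ℝ} (ht : t ∈ Icc 0 T) :
    ‖coeff k (u t).val‖ ≤ (1 + 2 * A / ν) * Real.exp (-(ν / 2) * t)
        * (‖coeff k (u 0).val‖ + ‖coeff k (w 0).val‖)
      + 2 / ν * (smoothBound ν A L₀ + smoothBound ν A L₁ * Real.exp (-(ν / 2) * t))
        / |(k : ℝ)| ^ 3 := by
  have hA0 : 0 ≤ A := by linarith [abs_nonneg α]
  set m := |(k : ℝ)| with hm
  have hm1 : 1 ≤ m := by rw [hm]; exact_mod_cast Int.one_le_abs hk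
  have hm0 : 0 < m := by linarith
  have hm4 : 1 ≤ m ^ 4 := one_le_pow₀ hm1
  set F₀ := forcingBound A L₀ with hF₀'
  set F₁ := forcingBound A L₁ with hF₁'
  have hF₀ : 0 ≤ F₀ := by rw [hF₀']; unfold forcingBound; positivity
  have hF₁ : 0 ≤ F₁ := by rw [hF₁']; unfold forcingBound; positivity
  set G₀ := smoothBound ν A L₀ with hG₀'
  set G₁ := smoothBound ν A L₁ with hG₁'
  have hG₀ : 0 ≤ G₀ := by rw [hG₀']; unfold smoothBound; positivity
  have hG₁ : 0 ≤ G₁ := by rw [hG₁']; unfold smoothBound; positivity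
  set W := ‖coeff k (u 0).val‖ + ‖coeff k (w 0).val‖ with hW
  have hW0 : 0 ≤ W := by positivity
  have key := norm_le_of_duhamel (a := ν * m ^ 4) (D := ν / 2) (T := T)
    (H₀ := m * G₀) (H₁ := A * m ^ 2 * W + m * G₁) (by positivity)
    (by nlinarith) (by positivity) (by positivity)
    (fun s hs => H.hasDerivWithinAt_coeff k hs) (fun s hs => ?_) ht
  · set E := Real.exp (-(ν / 2) * t)
    have hE : 0 < E := Real.exp_pos _
    have h1 : ‖coeff k (u 0).val‖ * E ≤ W * E := by
      gcongr
      linarith [norm_nonneg (coeff k (w 0).val)]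
    have h2 : 2 / (ν * m ^ 4) * (A * m ^ 2 * W * E) ≤ 2 * A / ν * (W * E) := by
      have : 2 / (ν * m ^ 4) * (A * m ^ 2 * W * E) = 2 * A / ν * (W * E) * (1 / m ^ 2) := by
        field_simp
      rw [this]
      refine mul_le_of_le_one_right (by positivity) ?_
      rw [div_le_one (by positivity)]
      exact one_le_pow₀ hm1
    have h3 : 2 / (ν * m ^ 4) * (m * G₀ + m * G₁ * E) = 2 / ν * (G₀ + G₁ * E) / m ^ 3 := by
      field_simp
    calc _ ≤ ‖coeff k (u 0).val‖ * E
          + 2 / (ν * m ^ 4) * (m * G₀ + (A * m ^ 2 * W + m * G₁) * E) := key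
      _ = ‖coeff k (u 0).val‖ * E + 2 / (ν * m ^ 4) * (A * m ^ 2 * W * E)
          + 2 / (ν * m ^ 4) * (m * G₀ + m * G₁ * E) := by ring
      _ ≤ W * E + 2 * A / ν * (W * E) + 2 / ν * (G₀ + G₁ * E) / m ^ 3 := by
          rw [h3]
          gcongr
      _ = _ := by ring
  · have z1 := coeff_bound_one hν hA hL₀ hL₁ H hL hk hs
    have z2 := coeff_bound_one hν hA' hL₀ hL₁ H'
      (fun t ht => (add_comm _ _).trans_le (hL t ht)) hk hs
    rw [← hm] at z1 z2
    have hS := hL s hs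
    set E := Real.exp (-(ν / 2) * s)
    have hE : 0 < E := Real.exp_pos _
    have hE1 : E ≤ 1 := Real.exp_le_one_iff.2 (by nlinarith [hs.1])
    have h4 := sq_le_of_le_add (norm_nonneg (u s).val) hE.le hE1
      (show ‖(u s).val‖ ≤ L₀ + L₁ * E by linarith [norm_nonneg (w s).val])
    have h3 : ‖coeff k (u s).val‖ + ‖coeff k (w s).val‖
        ≤ W * E + 4 / ν * (F₀ + F₁ * E) / m ^ 2 := by
      have : 4 / ν * (F₀ + F₁ * E) / m ^ 2 = 2 / ν * (F₀ + F₁ * E) / m ^ 2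
          + 2 / ν * (F₀ + F₁ * E) / m ^ 2 := by ring
      rw [this, hW]
      linarith
    calc ‖forcing α k (u s) (w s)‖
        ≤ A * m ^ 2 * (‖coeff k (u s).val‖ + ‖coeff k (w s).val‖) + m * ‖(u s).val‖ ^ 2 :=
          norm_forcing_le hA k _ _
      _ ≤ A * m ^ 2 * (W * E + 4 / ν * (F₀ + F₁ * E) / m ^ 2)
          + m * (2 * L₀ ^ 2 + 2 * L₁ ^ 2 * E) := by gcongr
      _ = A * m ^ 2 * (W * E) + 1 * (4 * A / ν * (F₀ + F₁ * E))
          + m * (2 * L₀ ^ 2 + 2 * L₁ ^ 2 * E) := by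
          field_simp
      _ ≤ A * m ^ 2 * (W * E) + m * (4 * A / ν * (F₀ + F₁ * E))
          + m * (2 * L₀ ^ 2 + 2 * L₁ ^ 2 * E) := by gcongr
      _ = _ := by
          rw [hG₀', hG₁']
          unfold smoothBound
          ring

end pointwise

/-! ### From coefficient bounds to norms of derivatives. -/

/-- The constant comparing `L²` norms with weighted sup norms of Fourier coefficients. -/
def sumConst : ℝ := Real.sqrt ((∑' k : ℤ, 1 / |(k : ℝ)| ^ 2) / Real.pi)

/-- Square, sum and use Parseval. At `k = 0` the quotient `q / 0` is `0`, so the hypothesis there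
allows no contribution from `q`; it is applied to derivatives, whose zero mode vanishes. -/
theorem norm_le_of_coeff_le {f f₁ f₂ : L2} {c q : ℝ} (hc : 0 ≤ c) (hq : 0 ≤ q)
    (h : ∀ k : ℤ, ‖coeff k f‖ ≤ c * (‖coeff k f₁‖ + ‖coeff k f₂‖) + q / |(k : ℝ)|) :
    ‖f‖ ≤ 2 * c * (‖f₁‖ + ‖f₂‖) + sumConst * q := by
  have hpi := Real.pi_pos
  have hsum : Summable fun k : ℤ => 1 / |(k : ℝ)| ^ 2 := by
    simpa only [sq_abs] using Real.summable_one_div_int_pow.2 one_lt_two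
  set Z := ∑' k : ℤ, 1 / |(k : ℝ)| ^ 2 with hZ
  have hZ0 : 0 ≤ Z := tsum_nonneg fun k => by positivity
  have hs : sumConst ^ 2 = Z / Real.pi := by
    rw [sumConst, Real.sq_sqrt (by positivity)]
  have hs0 : 0 ≤ sumConst := Real.sqrt_nonneg _
  have h2 := hasSum_le (fun k => ?_) (hasSum_coeff_sq f)
    ((((hasSum_coeff_sq f₁).add (hasSum_coeff_sq f₂)).mul_left (4 * c ^ 2)).add
      (hsum.hasSum.mul_left (2 * q ^ 2)))
  · refine le_of_sq_le_sq ?_ (by positivity)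
    rw [← hZ] at h2
    have h3 : ‖f‖ ^ 2 ≤ 4 * c ^ 2 * (‖f₁‖ ^ 2 + ‖f₂‖ ^ 2) + q ^ 2 * sumConst ^ 2 := by
      rw [hs]
      refine le_of_mul_le_mul_left (h2.trans (le_of_eq ?_)) Real.two_pi_pos
      field_simp
    have h4 : 0 ≤ c ^ 2 * (‖f₁‖ * ‖f₂‖) := by positivity
    have h5 : 0 ≤ c * (‖f₁‖ + ‖f₂‖) * (sumConst * q) := by positivity
    nlinarith
  · refine (pow_le_pow_left₀ (norm_nonneg _) (h k) 2).trans ?_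
    have e : 2 * q ^ 2 * (1 / |(k : ℝ)| ^ 2) = 2 * (q / |(k : ℝ)|) ^ 2 := by
      rw [div_pow]; ring
    rw [e]
    nlinarith [sq_nonneg (c * (‖coeff k f₁‖ + ‖coeff k f₂‖) - q / |(k : ℝ)|),
      mul_nonneg (sq_nonneg c) (sq_nonneg (‖coeff k f₁‖ - ‖coeff k f₂‖))]

theorem derivative_bound {ν α β A T L₀ L₁ : ℝ} (hν : 0 < ν) (hA : 1 + |α| ≤ A)
    (hA' : 1 + |β| ≤ A) (hL₀ : 0 ≤ L₀) (hL₁ : 0 ≤ L₁) {u w : ℝ → HDot2}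
    (H : IsTrajectory ν α T u w) (H' : IsTrajectory ν β T w u)
    (hL : ∀ t ∈ Icc 0 T, ‖(u t).val‖ + ‖(w t).val‖ ≤ L₀ + L₁ * Real.exp (-(ν / 2) * t))
    {t : ℝ} (ht : t ∈ Icc 0 T) :
    ‖(u t).d1‖ ≤ 2 * ((1 + 2 * A / ν) * Real.exp (-(ν / 2) * t)) * (‖(u 0).d1‖ + ‖(w 0).d1‖)
      + sumConst * (2 / ν * (smoothBound ν A L₀ + smoothBound ν A L₁ * Real.exp (-(ν / 2) * t))) ∧
    ‖(u t).d2‖ ≤ 2 * ((1 + 2 * A / ν) * Real.exp (-(ν / 2) * t)) * (‖(u 0).d2‖ + ‖(w 0).d2‖)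
      + sumConst
        * (2 / ν * (smoothBound ν A L₀ + smoothBound ν A L₁ * Real.exp (-(ν / 2) * t))) := by
  have hA0 : 0 ≤ A := by linarith [abs_nonneg α]
  set E := Real.exp (-(ν / 2) * t) with hE'
  have hE : 0 < E := Real.exp_pos _
  have hq : 0 ≤ 2 / ν * (smoothBound ν A L₀ + smoothBound ν A L₁ * E) := by
    unfold smoothBound forcingBound
    positivity
  set q := 2 / ν * (smoothBound ν A L₀ + smoothBound ν A L₁ * E) with hq'
  set c := (1 + 2 * A / ν) * E with hc'
  have hc : 0 ≤ c := by positivity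
  have key : ∀ k : ℤ, k ≠ 0 → 1 ≤ |(k : ℝ)| ∧ ‖coeff k (u t).val‖
      ≤ c * (‖coeff k (u 0).val‖ + ‖coeff k (w 0).val‖) + q / |(k : ℝ)| ^ 3 := fun k hk =>
    ⟨by exact_mod_cast Int.one_le_abs hk, coeff_bound_two hν hA hA' hL₀ hL₁ H H' hL hk ht⟩
  constructor
  · refine norm_le_of_coeff_le hc hq fun k => ?_
    rcases eq_or_ne k 0 with rfl | hk
    · rw [coeff_zero_of_mean_zero (u t).hasWeakDeriv_val.mean_zero, norm_zero]
      positivity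
    · obtain ⟨hm, hb⟩ := key k hk
      rw [(u t).hasWeakDeriv_val.norm_coeff, (u 0).hasWeakDeriv_val.norm_coeff,
        (w 0).hasWeakDeriv_val.norm_coeff]
      set m := |(k : ℝ)|
      have hm0 : 0 < m := by linarith
      -- One derivative leaves `m⁻²`; weakening it to `m⁻¹` lets both orders use the same summation
      -- lemma.
      have h1 : q / m ^ 2 ≤ q / m := by
        gcongr
        exact le_self_pow₀ hm two_ne_zero
      calc m * ‖coeff k (u t).val‖
          ≤ m * (c * (‖coeff k (u 0).val‖ + ‖coeff k (w 0).val‖) + q / m ^ 3) := by gcongr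
        _ = c * (m * ‖coeff k (u 0).val‖ + m * ‖coeff k (w 0).val‖) + q / m ^ 2 := by
          field_simp
        _ ≤ _ := by gcongr
  · refine norm_le_of_coeff_le hc hq fun k => ?_
    rcases eq_or_ne k 0 with rfl | hk
    · rw [coeff_zero_of_mean_zero (u t).hasWeakDeriv_d1.mean_zero, norm_zero]
      positivity
    · obtain ⟨hm, hb⟩ := key k hk
      rw [(u t).hasWeakDeriv_d1.norm_coeff, (u 0).hasWeakDeriv_d1.norm_coeff,
        (w 0).hasWeakDeriv_d1.norm_coeff, (u t).hasWeakDeriv_val.norm_coeff,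
        (u 0).hasWeakDeriv_val.norm_coeff, (w 0).hasWeakDeriv_val.norm_coeff]
      set m := |(k : ℝ)|
      have hm0 : 0 < m := by linarith
      calc m * (m * ‖coeff k (u t).val‖)
          ≤ m * (m * (c * (‖coeff k (u 0).val‖ + ‖coeff k (w 0).val‖) + q / m ^ 3)) := by gcongr
        _ = _ := by field_simp

/-! ### The main theorem -/

theorem HDot2.normL2_le_normH1 (f : HDot2) : f.normL2 ≤ f.normH1 :=
  Real.le_sqrt_of_sq_le (by unfold HDot2.normL2; linarith [sq_nonneg ‖f.d1‖])

theorem HDot2.normL2_le_normH2 (f : HDot2) : f.normL2 ≤ f.normH2 :=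
  Real.le_sqrt_of_sq_le (by
    unfold HDot2.normL2
    linarith [sq_nonneg ‖f.d1‖, sq_nonneg ‖f.d2‖])

theorem HDot2.norm_d1_le_normH1 (f : HDot2) : ‖f.d1‖ ≤ f.normH1 :=
  Real.le_sqrt_of_sq_le (by linarith [sq_nonneg ‖f.val‖])

theorem HDot2.norm_d1_le_normH2 (f : HDot2) : ‖f.d1‖ ≤ f.normH2 :=
  Real.le_sqrt_of_sq_le (by linarith [sq_nonneg ‖f.val‖, sq_nonneg ‖f.d2‖])

theorem HDot2.norm_d2_le_normH2 (f : HDot2) : ‖f.d2‖ ≤ f.normH2 :=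
  Real.le_sqrt_of_sq_le (by linarith [sq_nonneg ‖f.val‖, sq_nonneg ‖f.d1‖])

theorem HDot2.normH1_le (f : HDot2) : f.normH1 ≤ 2 * ‖f.d1‖ := by
  refine Real.sqrt_le_iff.2 ⟨by positivity, ?_⟩
  have := pow_le_pow_left₀ (norm_nonneg _) f.norm_val_le 2
  nlinarith [sq_nonneg ‖f.d1‖]

theorem HDot2.normH2_le (f : HDot2) : f.normH2 ≤ 2 * ‖f.d2‖ := by
  refine Real.sqrt_le_iff.2 ⟨by positivity, ?_⟩
  have h1 := pow_le_pow_left₀ (norm_nonneg _) f.norm_val_le 2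
  have h2 := pow_le_pow_left₀ (norm_nonneg _) f.norm_d1_le 2
  nlinarith [sq_nonneg ‖f.d2‖]

theorem smoothBound_mono {ν A L L' : ℝ} (hν : 0 < ν) (hA : 0 ≤ A) (hL : 0 ≤ L) (h : L ≤ L') :
    smoothBound ν A L ≤ smoothBound ν A L' := by
  unfold smoothBound forcingBound
  gcongr

theorem IsSolution.isTrajectory {ν α₁ α₂ T : ℝ} {u₁₀ u₂₀ : HDot2} {u₁ u₂ : ℝ → HDot2}
    (hT : 0 ≤ T) (H : IsSolution ν α₁ α₂ T u₁₀ u₂₀ u₁ u₂) :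
    IsTrajectory ν α₁ T (extend hT u₁) (extend hT u₂) ∧
      IsTrajectory ν α₂ T (extend hT u₂) (extend hT u₁) ∧
      extend hT u₁ 0 = u₁₀ ∧ extend hT u₂ 0 = u₂₀ :=
  ⟨H.equation₁.isTrajectory hT H.continuous₁ H.continuous₂,
    H.equation₂.isTrajectory hT H.continuous₂ H.continuous₁,
    (extend_eq hT u₁ (left_mem_Icc.2 hT)).trans H.initial₁,
    (extend_eq hT u₂ (left_mem_Icc.2 hT)).trans H.initial₂⟩

/-- Bounds for the sums of the norms of the first and second derivatives. -/
theorem exists_derivative_sum_bound (ν α₁ α₂ : ℝ) (hν : 0 < ν) :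
    ∃ c a b : ℝ, 0 < c ∧ 0 ≤ a ∧ 0 ≤ b ∧
      (∀ (u₁₀ u₂₀ : HDot2) (T : ℝ) (u₁ u₂ : ℝ → HDot2), 0 < T →
        IsSolution ν α₁ α₂ T u₁₀ u₂₀ u₁ u₂ → ∀ t ∈ Icc 0 T,
          (u₁ t).normL2 + (u₂ t).normL2
            ≤ c + c * (u₁₀.normL2 + u₂₀.normL2) * Real.exp (-(ν / 2) * t)) ∧
      ∀ R : ℝ, ∃ M : ℝ, ∀ (u₁₀ u₂₀ : HDot2) (T : ℝ) (u₁ u₂ : ℝ → HDot2), 0 < T →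
        u₁₀.normL2 + u₂₀.normL2 ≤ R → IsSolution ν α₁ α₂ T u₁₀ u₂₀ u₁ u₂ → ∀ t ∈ Icc 0 T,
          ‖(u₁ t).d1‖ + ‖(u₂ t).d1‖
            ≤ a + (b * (‖u₁₀.d1‖ + ‖u₂₀.d1‖) + M) * Real.exp (-(ν / 2) * t) ∧
          ‖(u₁ t).d2‖ + ‖(u₂ t).d2‖
            ≤ a + (b * (‖u₁₀.d2‖ + ‖u₂₀.d2‖) + M) * Real.exp (-(ν / 2) * t) := by
  obtain ⟨c, hc, hL2⟩ := exists_L2_bound ν α₁ α₂ hν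
  set A := 1 + |α₁| + |α₂| with hA
  have hA1 : 1 + |α₁| ≤ A := by linarith [abs_nonneg α₂]
  have hA2 : 1 + |α₂| ≤ A := by linarith [abs_nonneg α₁]
  have hA0 : 0 ≤ A := by positivity
  have hσ : 0 ≤ sumConst := Real.sqrt_nonneg _
  have hB : 0 ≤ smoothBound ν A c := by
    unfold smoothBound forcingBound
    positivity
  -- The persistent part uses only the constant `c` of the `L²` bound and so is independent of the
  -- data; the size `R` enters only through the coefficient of the decaying exponential.
  refine ⟨c, 2 * (sumConst * (2 / ν * smoothBound ν A c)), 4 * (1 + 2 * A / ν), hc, by positivity,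
    by positivity, fun u₁₀ u₂₀ T u₁ u₂ hT H t ht => ?_,
    fun R => ⟨2 * (sumConst * (2 / ν * smoothBound ν A (c * R))),
      fun u₁₀ u₂₀ T u₁ u₂ hT hR H t ht => ?_⟩⟩
  · obtain ⟨H₁, H₂, i₁, i₂⟩ := H.isTrajectory hT.le
    have := hL2 T _ _ H₁ H₂ t ht
    rwa [i₁, i₂, extend_eq hT.le u₁ ht, extend_eq hT.le u₂ ht] at this
  · obtain ⟨H₁, H₂, i₁, i₂⟩ := H.isTrajectory hT.le
    have hL := hL2 T _ _ H₁ H₂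
    rw [i₁, i₂] at hL
    set N := ‖u₁₀.val‖ + ‖u₂₀.val‖
    have hN : 0 ≤ N := by positivity
    have d₁ := derivative_bound hν hA1 hA2 hc.le (mul_nonneg hc.le hN) H₁ H₂ hL ht
    have d₂ := derivative_bound hν hA2 hA1 hc.le (mul_nonneg hc.le hN) H₂ H₁
      (fun s hs => (add_comm _ _).trans_le (hL s hs)) ht
    rw [i₁, i₂, extend_eq hT.le u₁ ht] at d₁
    rw [i₁, i₂, extend_eq hT.le u₂ ht] at d₂
    set E := Real.exp (-(ν / 2) * t)
    have hE : 0 < E := Real.exp_pos _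
    have hM : sumConst * (2 / ν * smoothBound ν A (c * N)) * E
        ≤ sumConst * (2 / ν * smoothBound ν A (c * R)) * E := by
      gcongr
      exact smoothBound_mono hν hA0 (mul_nonneg hc.le hN) (mul_le_mul_of_nonneg_left hR hc.le)
    constructor
    · linarith [d₁.1, d₂.1]
    · linarith [d₁.2, d₂.2]

end KSSystem

end

theorem mainTheorem5 (ν α₁ α₂ : ℝ) (hν : 0 < ν) :
    ∃ C D : ℝ, 0 < C ∧ 0 < D ∧
      -- the bound in `L²`
      (∀ (u₁₀ u₂₀ : KSSystem.HDot2) (T : ℝ) (u₁ u₂ : ℝ → KSSystem.HDot2), 0 < T →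
        KSSystem.IsSolution ν α₁ α₂ T u₁₀ u₂₀ u₁ u₂ →
        ∀ t ∈ Set.Icc 0 T,
          (u₁ t).normL2 + (u₂ t).normL2
            ≤ C + C * (u₁₀.normL2 + u₂₀.normL2) * Real.exp (-D * t)) ∧
      -- the bound in `H¹`
      (∀ R : ℝ, ∃ M : ℝ,
        ∀ (u₁₀ u₂₀ : KSSystem.HDot2) (T : ℝ) (u₁ u₂ : ℝ → KSSystem.HDot2), 0 < T →
        u₁₀.normH1 + u₂₀.normH1 ≤ R →
        KSSystem.IsSolution ν α₁ α₂ T u₁₀ u₂₀ u₁ u₂ →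
        ∀ t ∈ Set.Icc 0 T,
          (u₁ t).normH1 + (u₂ t).normH1 ≤ C + M * Real.exp (-D * t)) ∧
      -- the bounds in `H²` and in `L^∞`
      (∀ R : ℝ, ∃ M : ℝ,
        ∀ (u₁₀ u₂₀ : KSSystem.HDot2) (T : ℝ) (u₁ u₂ : ℝ → KSSystem.HDot2), 0 < T →
        u₁₀.normH2 + u₂₀.normH2 ≤ R →
        KSSystem.IsSolution ν α₁ α₂ T u₁₀ u₂₀ u₁ u₂ →
        ∀ t ∈ Set.Icc 0 T,
          (u₁ t).normH2 + (u₂ t).normH2 ≤ C + M * Real.exp (-D * t) ∧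
          MeasureTheory.MemLp (u₁ t).val ⊤ KSSystem.cell ∧
          MeasureTheory.MemLp (u₂ t).val ⊤ KSSystem.cell ∧
          MeasureTheory.eLpNorm (u₁ t).val ⊤ KSSystem.cell
            + MeasureTheory.eLpNorm (u₂ t).val ⊤ KSSystem.cell
              ≤ ENNReal.ofReal (C + M * Real.exp (-D * t))) := by
  obtain ⟨c, a, b, hc, ha, hb, hL2, hd⟩ := KSSystem.exists_derivative_sum_bound ν α₁ α₂ hν
  choose M hM using hd
  have hκ : 0 ≤ ‖KSSystem.one‖ := norm_nonneg _
  have hκa : 0 ≤ ‖KSSystem.one‖ * a := mul_nonneg hκ ha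
  -- The three summands of `C` serve the `L²`, the `H¹` and `H²`, and the `L^∞` bounds: by Poincaré
  -- the Sobolev norms are at most twice the top derivative, and `‖one‖` is the Sobolev constant.
  -- The absolute value makes the last coefficient nonnegative, as needed when enlarging the factor
  -- to the maximum.
  refine ⟨c + 2 * a + ‖KSSystem.one‖ * a, ν / 2, by positivity, by positivity, ?_, fun R =>
    ⟨2 * (b * R + M R), ?_⟩, fun R => ⟨max 2 ‖KSSystem.one‖ * |b * R + M R|, ?_⟩⟩
  · intro u₁₀ u₂₀ T u₁ u₂ hT H t ht
    refine (hL2 u₁₀ u₂₀ T u₁ u₂ hT H t ht).trans ?_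
    have h0 : 0 ≤ u₁₀.normL2 + u₂₀.normL2 := add_nonneg (norm_nonneg _) (norm_nonneg _)
    gcongr <;> linarith
  · intro u₁₀ u₂₀ T u₁ u₂ hT hR H t ht
    have h1 := (hM R u₁₀ u₂₀ T u₁ u₂ hT
      (by linarith [u₁₀.normL2_le_normH1, u₂₀.normL2_le_normH1]) H t ht).1
    have hE := Real.exp_pos (-(ν / 2) * t)
    have h2 : b * (‖u₁₀.d1‖ + ‖u₂₀.d1‖) ≤ b * R :=
      mul_le_mul_of_nonneg_left (by linarith [u₁₀.norm_d1_le_normH1, u₂₀.norm_d1_le_normH1]) hb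
    have h3 := mul_le_mul_of_nonneg_right (add_le_add_left h2 (M R)) hE.le
    linarith [(u₁ t).normH1_le, (u₂ t).normH1_le]
  · intro u₁₀ u₂₀ T u₁ u₂ hT hR H t ht
    obtain ⟨h1, h1'⟩ := hM R u₁₀ u₂₀ T u₁ u₂ hT
      (by linarith [u₁₀.normL2_le_normH2, u₂₀.normL2_le_normH2]) H t ht
    have hE := Real.exp_pos (-(ν / 2) * t)
    set E := Real.exp (-(ν / 2) * t)
    have h2 : b * (‖u₁₀.d1‖ + ‖u₂₀.d1‖) ≤ b * R :=
      mul_le_mul_of_nonneg_left (by linarith [u₁₀.norm_d1_le_normH2, u₂₀.norm_d1_le_normH2]) hb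
    have h2' : b * (‖u₁₀.d2‖ + ‖u₂₀.d2‖) ≤ b * R :=
      mul_le_mul_of_nonneg_left (by linarith [u₁₀.norm_d2_le_normH2, u₂₀.norm_d2_le_normH2]) hb
    have h0 : 0 ≤ |b * R + M R| * E := by positivity
    have h3 : ‖(u₁ t).d1‖ + ‖(u₂ t).d1‖ ≤ a + |b * R + M R| * E := by
      refine h1.trans ?_
      gcongr
      linarith [le_abs_self (b * R + M R)]
    have h3' : ‖(u₁ t).d2‖ + ‖(u₂ t).d2‖ ≤ a + |b * R + M R| * E := by
      refine h1'.trans ?_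
      gcongr
      linarith [le_abs_self (b * R + M R)]
    refine ⟨?_, (u₁ t).memLp_top, (u₂ t).memLp_top, ?_⟩
    · have := mul_le_mul_of_nonneg_right (le_max_left 2 ‖KSSystem.one‖) h0
      linarith [(u₁ t).normH2_le, (u₂ t).normH2_le]
    · refine (add_le_add (u₁ t).eLpNorm_top_le (u₂ t).eLpNorm_top_le).trans ?_
      rw [← ENNReal.ofReal_add (by positivity) (by positivity)]
      refine ENNReal.ofReal_le_ofReal ?_
      have h4 := mul_le_mul_of_nonneg_right (le_max_right 2 ‖KSSystem.one‖) h0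
      have h5 := mul_le_mul_of_nonneg_left h3 hκ
      linarith
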